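/- Let $n=(n_1,\dots,n_r)$ and $d=(d_1,\dots,d_r)$ be tuples of positive integers. Let $H_{n_i,d_i}$ be the space of real homogeneous polynomials of degree $d_i$ in $x_0,\dots,x_{n_i}$, with its scaled monomials $m_\alpha=\sqrt{d_i!/(\alpha_0!\cdots\alpha_{n_i}!)}\;x^\alpha$, $|\alpha|=d_i$. Equip $\mathscr H=H_{n_1,d_1}\otimes\cdots\otimes H_{n_r,d_r}$ with the (Bombieri–Weyl) inner product for which the tensors $m_{\alpha_1}\otimes\cdots\otimes m_{\alpha_r}$ form an orthonormal basis. Let $\mathbb X\subset\mathscr H$ be the spherical Segre–Veronese manifold, that is, the set of all tensors $f_1\otimes\cdots\otimes f_r$ of norm $1$ with each $f_i=\pm\ell_i^{d_i}$ for a linear form $\ell_i$, and let $E=x_0^{d_1}\otimes\cdots\otimes x_0^{d_r}\in\mathbb X$. Let $T_E\mathbb X$ be the tangent space and let $N_E\mathbb X$ be the normal space of $\mathbb X$ at $E$ inside the unit sphere of $\mathscr H$ (the vectors orthogonal to $T_E\mathbb X$ and to $E$). The second fundamental form is $\mathrm{II}(v,w,a)=\langle \partial_w Y(E),a\rangle$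 for $v,w\in T_E\mathbb X$, $a\in N_E\mathbb X$, where $Y$ is any local smooth tangent field of $\mathbb X$ with $Y(E)=v$. The Weingarten map $L_F:T_E\mathbb X\to T_E\mathbb X$ in direction $F\in N_E\mathbb X$ is the linear map with $\mathrm{II}(v,w,F)=\langle v,L_F w\rangle$. Define $$\mathcal W_i=\operatorname{span}\{m_{\alpha_1}\otimes\cdots\otimes m_{\alpha_r} : (\alpha_i)_0=d_i-2,\ (\alpha_s)_0=d_s \text{ for } s\ne i\},$$ $$\mathcal G_{i,j}=\operatorname{span}\{m_{\alpha_1}\otimes\cdots\otimes m_{\alpha_r} : (\alpha_i)_0=d_i-1,\ (\alpha_j)_0=d_j-1,\ (\alpha_s)_0=d_s \text{ for } s\ne i,j\},$$ $\mathcal W=\sum_i\mathcal W_i$, $\mathcal G=\sum_{i<j}\mathcal G_{i,j}$ and $\mathcal P=(\mathcal W+\mathcal G)^\perp\cap N_E\mathbb X$. For $k,l\in\{1,\dots,n_i\}$ write $m^{(i)}_k=\sqrt{d_i}\,x_0^{d_i-1}x_k$ and, for $d_i\ge 2$, $m^{(i)}_{k,l}$ for the scaled monomial of $H_{n_i,d_i}$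 proportional to $x_0^{d_i-2}x_kx_l$; for $d_i=1$ set $m^{(i)}_{k,l}=0$. **Theorem (Weingarten map of Segre–Veronese manifolds).** 1. $N_E\mathbb X=\mathcal P\oplus\mathcal W\oplus\mathcal G$ is an orthogonal decomposition. The spaces $\mathcal W_i$ are pairwise orthogonal, and so are the spaces $\mathcal G_{i,j}$, $i<j$. The elements of $\mathcal W_i$ are exactly the tensors $W_i=x_0^{d_1}\otimes\cdots\otimes f_i\otimes\cdots\otimes x_0^{d_r}$ ($f_i$ in slot $i$) with $$f_i=\sum_{1\le k<l\le n_i}f_{i,(k,l)}\,m^{(i)}_{k,l}+\sum_{1\le k\le n_i}f_{i,(k,k)}\,m^{(i)}_{k,k},\qquad f_{i,(l,k)}=f_{i,(k,l)}\in\mathbb R.$$ The elements of $\mathcal G_{i,j}$, $i<j$, are exactly the tensors $$G_{i,j}=\sum_{k=1}^{n_i}\sum_{l=1}^{n_j}g_{(i,j),(k,l)}\;x_0^{d_1}\otimes\cdots\otimes m^{(i)}_k\otimes\cdots\otimes m^{(j)}_l\otimes\cdots\otimes x_0^{d_r}$$ with $m^{(i)}_k$ in slot $i$, $m^{(j)}_l$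 in slot $j$, and $g_{(i,j),(k,l)}\in\mathbb R$. 2. The tensors $x_0^{d_1}\otimes\cdots\otimes m^{(i)}_k\otimes\cdots\otimes x_0^{d_r}$ ($m^{(i)}_k$ in slot $i$), $1\le i\le r$, $1\le k\le n_i$, form an orthonormal basis of $T_E\mathbb X$. Every $F\in N_E\mathbb X$ can be written as $F=P+\sum_iW_i+\sum_{i<j}G_{i,j}$ with $P\in\mathcal P$ and with $W_i$, $G_{i,j}$ as in part 1. The Weingarten map $L_F$ exists and is unique, and, whichever such expression of $F$ is used, its matrix in this orthonormal basis is the symmetric block matrix $$\begin{bmatrix}L_1&L_{1,2}&\cdots&L_{1,r}\\ L_{1,2}^T&L_2&\cdots&L_{2,r}\\ \vdots&\vdots&\ddots&\vdots\\ L_{1,r}^T&L_{2,r}^T&\cdots&L_r\end{bmatrix},\qquad (L_i)_{k,l}=\sqrt{\frac{d_i-1}{d_i}}\cdot\begin{cases}\sqrt2\,f_{i,(k,k)},&k=l,\\ f_{i,(k,l)},&k\ne l,\end{cases}\qquad (L_{i,j})_{k,l}=g_{(i,j),(k,l)}\quad(i<j).$$ In particular, the component $P$ does not contribute: if $F\in\mathcal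 P$, then $L_F=0$. -/

import Mathlib

open Module MvPolynomial
open scoped ContDiff InnerProductSpace TensorProduct

namespace SegreVeronese

noncomputable section

/-! ### Extrinsic geometry of a submanifold of the unit sphere of a Euclidean space -/

section Extrinsic

variable {V : Type*} [NormedAddCommGroup V] [InnerProductSpace ℝ V]

/-- The tangent space of `M` at `x`: the linear space of velocities at `x` of smooth curves of `V`
that stay in `M`. (For an embedded submanifold the velocities already form a linear space; an
open-interval curve can be reparametrized to all of `ℝ` without changing its velocity at `0`.) -/
def tangentSpace (M : Set V) (x : V) : Submodule ℝ V :=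
  Submodule.span ℝ
    {v | ∃ γ : ℝ → V, ContDiff ℝ ∞ γ ∧ (∀ t, γ t ∈ M) ∧ γ 0 = x ∧ deriv γ 0 = v}

/-- The normal space at `x` of `M`, as a submanifold of the unit sphere: the vectors that are
tangent to the sphere at `x` (orthogonal to `x`) and orthogonal to the tangent space of `M`. -/
def normalSpace (M : Set V) (x : V) : Submodule ℝ V :=
  (tangentSpace M x ⊔ Submodule.span ℝ {x})ᗮ

/-- `Y` is (an ambient extension of) a smooth tangent field of `M`, defined near `x`. -/
def IsLocalTangentField (M : Set V) (x : V) (Y : V → V) : Prop :=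
  ∃ U : Set V, IsOpen U ∧ x ∈ U ∧ ContDiffOn ℝ ∞ Y U ∧ ∀ u ∈ U ∩ M, Y u ∈ tangentSpace M u

/-- The trilinear form `II` on `T_x M × T_x M × N_x M` is the second fundamental form of `M` at
`x`: every tangent vector `v` at `x` is the value of a local smooth tangent field, and whichever
such field `Y` is used, `II (v, w, a)` is the inner product of `a` with the derivative of `Y`
at `x` in direction `w`. At most one form has this property. -/
structure IsSecondFundamentalForm (M : Set V) (x : V)
    (II : tangentSpace M x →ₗ[ℝ] tangentSpace M x →ₗ[ℝ] normalSpace M x →ₗ[ℝ] ℝ) : Prop where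
  exists_field : ∀ v : tangentSpace M x, ∃ Y : V → V, IsLocalTangentField M x Y ∧ Y x = v
  apply_eq : ∀ (v w : tangentSpace M x) (a : normalSpace M x) (Y : V → V),
    IsLocalTangentField M x Y → Y x = v → II v w a = ⟪fderiv ℝ Y x (w : V), (a : V)⟫_ℝ

/-- `L` is the Weingarten map of `M` at `x` in the normal direction `a`:
`II (v, w, a) = ⟪v, L w⟫` for all tangent vectors `v`, `w`. -/
def IsWeingartenMap (M : Set V) (x : V) (a : normalSpace M x)
    (L : tangentSpace M x →ₗ[ℝ] tangentSpace M x) : Prop :=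
  ∃ II, IsSecondFundamentalForm M x II ∧ ∀ v w : tangentSpace M x, II v w a = ⟪v, L w⟫_ℝ

end Extrinsic

/-! ### Homogeneous polynomials and the scaled monomials -/

/-- The space `H_{n,d}` of real homogeneous polynomials of degree `d` in `x_0, …, x_n`. -/
abbrev HomPoly (n d : ℕ) : Submodule ℝ (MvPolynomial (Fin (n + 1)) ℝ) :=
  homogeneousSubmodule (Fin (n + 1)) ℝ d

/-- Exponent vectors `(α_0, …, α_n)` of total degree `d`. -/
abbrev MultiIndex (n d : ℕ) : Type := {α : Fin (n + 1) →₀ ℕ // α.degree = d}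

instance (n d : ℕ) : Finite (MultiIndex n d) :=
  ((Finsupp.finite_of_degree_le d).subset
    (fun _ h => le_of_eq h : {α : Fin (n + 1) →₀ ℕ | α.degree = d} ⊆ _)).to_subtype

instance (n d : ℕ) : Fintype (MultiIndex n d) := Fintype.ofFinite _

/-- The scaled monomial `m_α = √(d! / (α_0! ⋯ α_n!)) x^α` of `H_{n,d}`, for `|α| = d`. When
`|α| ≠ d` there is no such monomial in `H_{n,d}` and the value is `0`. -/
def scaledMonomial {n d : ℕ} (α : Fin (n + 1) →₀ ℕ) : HomPoly n d :=
  if h : α.degree = d then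
    ⟨monomial α √(α.multinomial : ℝ),
      (mem_homogeneousSubmodule d _).2 (isHomogeneous_monomial _ h)⟩
  else 0

theorem multinomial_pos {σ : Type*} (α : σ →₀ ℕ) : 0 < α.multinomial := by
  rw [Finsupp.multinomial_eq]
  exact Nat.multinomial_pos _ _

theorem coeff_scaledMonomial {n d : ℕ} (α : MultiIndex n d) (β : Fin (n + 1) →₀ ℕ) :
    coeff β (scaledMonomial (d := d) α.1 : MvPolynomial (Fin (n + 1)) ℝ)
      = if α.1 = β then √(α.1.multinomial : ℝ) else 0 := by
  classical
  rw [scaledMonomial, dif_pos α.2]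
  exact coeff_monomial _ _ _

theorem sqrt_multinomial_ne_zero {σ : Type*} (α : σ →₀ ℕ) : √(α.multinomial : ℝ) ≠ 0 :=
  (Real.sqrt_pos.2 (Nat.cast_pos.2 (multinomial_pos α))).ne'

/-- The basis of scaled monomials of `H_{n,d}`. -/
def monomialBasis (n d : ℕ) : Basis (MultiIndex n d) ℝ (HomPoly n d) :=
  Basis.ofEquivFun
    { toFun := fun f α => coeff α.1 (f : MvPolynomial (Fin (n + 1)) ℝ) / √(α.1.multinomial : ℝ)
      map_add' := fun f g => by
        funext α
        simp [add_div]
      map_smul' := fun c f => by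
        funext α
        simp [mul_div_assoc]
      invFun := fun c => ∑ α, c α • scaledMonomial α.1
      left_inv := fun f => by
        classical
        apply Subtype.ext
        ext β
        simp only [Submodule.coe_sum, Submodule.coe_smul, coeff_sum, coeff_smul,
          coeff_scaledMonomial, smul_eq_mul, mul_ite, mul_zero]
        by_cases hβ : β.degree = d
        · rw [Finset.sum_eq_single (⟨β, hβ⟩ : MultiIndex n d)]
          · simp [div_mul_cancel₀ _ (sqrt_multinomial_ne_zero β)]
          · intro α _ hα
            rw [if_neg]
            exact fun h => hα (Subtype.ext h)
          · intro h
            exact absurd (Finset.mem_univ _) h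
        · rw [Finset.sum_eq_zero]
          · symm
            exact ((mem_homogeneousSubmodule d _).1 f.2).coeff_eq_zero hβ
          · intro α _
            rw [if_neg]
            rintro rfl
            exact hβ α.2
      right_inv := fun c => by
        classical
        funext β
        simp only [Submodule.coe_sum, Submodule.coe_smul, coeff_sum, coeff_smul,
          coeff_scaledMonomial, smul_eq_mul, mul_ite, mul_zero]
        rw [Finset.sum_eq_single β]
        · simp [mul_div_cancel_right₀ _ (sqrt_multinomial_ne_zero β.1)]
        · intro α _ hα
          rw [if_neg]
          exact fun h => hα (Subtype.ext h)
        · intro h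
          exact absurd (Finset.mem_univ _) h }

theorem monomialBasis_apply (n d : ℕ) (α : MultiIndex n d) :
    monomialBasis n d α = scaledMonomial α.1 := by
  classical
  rw [monomialBasis, Basis.coe_ofEquivFun]
  change ∑ β, (Pi.single α (1 : ℝ) : MultiIndex n d → ℝ) β • scaledMonomial β.1 = _
  rw [Finset.sum_eq_single α]
  · simp
  · intro β _ hβ
    simp [Pi.single_eq_of_ne hβ]
  · intro h
    exact absurd (Finset.mem_univ _) h

/-! ### Partially symmetric tensors with the Bombieri–Weyl inner product -/

/-- The space `H_{n_1,d_1} ⊗ ⋯ ⊗ H_{n_r,d_r}`. -/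
def PSTensor {r : ℕ} (n d : Fin r → ℕ) : Type :=
  ⨂[ℝ] i, HomPoly (n i) (d i)

section Tensor

variable {r : ℕ} (n d : Fin r → ℕ)

instance : AddCommGroup (PSTensor n d) :=
  inferInstanceAs (AddCommGroup (⨂[ℝ] i, HomPoly (n i) (d i)))

instance : Module ℝ (PSTensor n d) :=
  inferInstanceAs (Module ℝ (⨂[ℝ] i, HomPoly (n i) (d i)))

/-- The simple tensor `f_1 ⊗ ⋯ ⊗ f_r`. -/
def simpleTensor {n d : Fin r → ℕ} (f : ∀ i, HomPoly (n i) (d i)) : PSTensor n d :=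
  PiTensorProduct.tprod ℝ f

/-- The basis `m_{α_1} ⊗ ⋯ ⊗ m_{α_r}`. -/
def tensorBasis : Basis (∀ i, MultiIndex (n i) (d i)) ℝ (PSTensor n d) :=
  Basis.piTensorProduct fun i => monomialBasis (n i) (d i)

theorem tensorBasis_apply (α : ∀ i, MultiIndex (n i) (d i)) :
    tensorBasis n d α = simpleTensor fun i => scaledMonomial (α i).1 := by
  have h := Basis.piTensorProduct_apply (R := ℝ) (fun i => monomialBasis (n i) (d i)) α
  simp only [monomialBasis_apply] at h
  exact h

/-- The Bombieri–Weyl inner product `⟨F, G⟩ = ∑ F_{α_1,…,α_r} G_{α_1,…,α_r}`, in the coordinates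
with respect to `m_{α_1} ⊗ ⋯ ⊗ m_{α_r}`. -/
abbrev innerCore : InnerProductSpace.Core ℝ (PSTensor n d) where
  inner F G := ∑ α, (tensorBasis n d).repr F α * (tensorBasis n d).repr G α
  conj_inner_symm F G := by simp [mul_comm]
  re_inner_nonneg F := by
    simpa using Finset.sum_nonneg fun α _ => mul_self_nonneg ((tensorBasis n d).repr F α)
  add_left F G K := by simp [add_mul, Finset.sum_add_distrib]
  smul_left F G c := by simp [mul_assoc, Finset.mul_sum]
  definite F h := by
    apply (tensorBasis n d).ext_elem
    intro α
    rw [Finset.sum_eq_zero_iff_of_nonneg fun α _ => mul_self_nonneg _] at h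
    simpa using h α (Finset.mem_univ α)

instance : NormedAddCommGroup (PSTensor n d) := (innerCore n d).toNormedAddCommGroup

instance : InnerProductSpace ℝ (PSTensor n d) := InnerProductSpace.ofCore (innerCore n d).toCore

/-! ### The spherical Segre–Veronese manifold -/

/-- The cone of signed `d`-th powers `± ℓ^d` of linear forms `ℓ`. -/
def veroneseCone (n d : ℕ) : Set (HomPoly n d) :=
  {f | ∃ ℓ ∈ HomPoly n 1, (f : MvPolynomial (Fin (n + 1)) ℝ) = ℓ ^ d ∨
    (f : MvPolynomial (Fin (n + 1)) ℝ) = -ℓ ^ d}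

/-- The spherical Segre–Veronese manifold: simple tensors of unit norm with factors `± ℓ_i^{d_i}`. -/
def segreVeronese : Set (PSTensor n d) :=
  {F | ∃ f : ∀ i, HomPoly (n i) (d i), (∀ i, f i ∈ veroneseCone (n i) (d i)) ∧ F = simpleTensor f}
    ∩ Metric.sphere 0 1

/-- The polynomial `x_0^d` in `H_{n,d}`. -/
def x0Pow (n d : ℕ) : HomPoly n d :=
  ⟨X 0 ^ d, (mem_homogeneousSubmodule d _).2 (isHomogeneous_X_pow 0 d)⟩

/-- The distinguished point `E = x_0^{d_1} ⊗ ⋯ ⊗ x_0^{d_r}`. -/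
def basePoint : PSTensor n d := simpleTensor fun i => x0Pow (n i) (d i)

/-! ### Decomposition of the normal space -/

/-- The span of the `m_{α_1} ⊗ ⋯ ⊗ m_{α_r}` with `(α_i)_0 = d_i - 2` and `(α_k)_0 = d_k` for
`k ≠ i`. -/
def spaceWi (i : Fin r) : Submodule ℝ (PSTensor n d) :=
  Submodule.span ℝ {F | ∃ α : ∀ k, MultiIndex (n k) (d k),
    (α i).1 0 + 2 = d i ∧ (∀ k, k ≠ i → (α k).1 0 = d k) ∧
    F = simpleTensor fun k => scaledMonomial (α k).1}

/-- The span of the `m_{α_1} ⊗ ⋯ ⊗ m_{α_r}` with `(α_i)_0 = d_i - 1`, `(α_j)_0 = d_j - 1` and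
`(α_k)_0 = d_k` for `k ≠ i, j`. -/
def spaceGij (i j : Fin r) : Submodule ℝ (PSTensor n d) :=
  Submodule.span ℝ {F | ∃ α : ∀ k, MultiIndex (n k) (d k),
    (α i).1 0 + 1 = d i ∧ (α j).1 0 + 1 = d j ∧ (∀ k, k ≠ i → k ≠ j → (α k).1 0 = d k) ∧
    F = simpleTensor fun k => scaledMonomial (α k).1}

/-- `W`, the sum of the `W_i`. -/
def spaceW : Submodule ℝ (PSTensor n d) := ⨆ i, spaceWi n d i

/-- `G`, the sum of the `G_{i,j}` with `i < j`. -/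
def spaceG : Submodule ℝ (PSTensor n d) := ⨆ (i) (j) (_ : i < j), spaceGij n d i j

/-- `P`, the orthogonal complement of `W ⊕ G` in the normal space at `E`. -/
def spaceP : Submodule ℝ (PSTensor n d) :=
  (spaceW n d ⊔ spaceG n d)ᗮ ⊓ normalSpace (segreVeronese n d) (basePoint n d)

/-- The scaled monomial of `H_{n,d}` proportional to `x_0^{d-1} x_k`, `1 ≤ k ≤ n` (the index
`k : Fin n` stands for the variable `x_{k+1}`). -/
def linMonomial {n d : ℕ} (k : Fin n) : HomPoly n d :=
  scaledMonomial (Finsupp.single 0 (d - 1) + Finsupp.single k.succ 1)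

/-- The polynomial `∑_{k<l} f_{kl} m_{(d-2,…,1,…,1,…)} + ∑_k f_{kk} m_{(d-2,…,2,…)}`, where the
monomials are those of `x_0^{d-2} x_k x_l` and `x_0^{d-2} x_k^2`. It vanishes for `d = 1`, when
there are no such monomials. -/
def quadPoly {n d : ℕ} (f : Matrix (Fin n) (Fin n) ℝ) : HomPoly n d :=
  ∑ k, ∑ l ∈ Finset.Ioi k,
      f k l • scaledMonomial
        (Finsupp.single 0 (d - 2) + Finsupp.single k.succ 1 + Finsupp.single l.succ 1) +
    ∑ k, f k k • scaledMonomial (Finsupp.single 0 (d - 2) + Finsupp.single k.succ 2)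

/-- The tensor `x_0^{d_1} ⊗ ⋯ ⊗ √d_i x_0^{d_i-1} x_k ⊗ ⋯ ⊗ x_0^{d_r}`. -/
def tangentVec (i : Fin r) (k : Fin (n i)) : PSTensor n d :=
  simpleTensor (Function.update (fun j => x0Pow (n j) (d j)) i (linMonomial k))

/-- The tensor `x_0^{d_1} ⊗ ⋯ ⊗ f_i ⊗ ⋯ ⊗ x_0^{d_r}`, with `f_i = quadPoly f` in the `i`-th slot. -/
def tensorW (i : Fin r) (f : Matrix (Fin (n i)) (Fin (n i)) ℝ) : PSTensor n d :=
  simpleTensor (Function.update (fun j => x0Pow (n j) (d j)) i (quadPoly f))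

/-- The tensor `∑_{k,l} g_{kl} x_0^{d_1} ⊗ ⋯ ⊗ m_{(d_i-1,…,1,…)} ⊗ ⋯ ⊗ m_{(d_j-1,…,1,…)} ⊗ ⋯`,
with the monomial of `x_0^{d_i-1} x_k` in the `i`-th slot, that of `x_0^{d_j-1} x_l` in the `j`-th
slot, and `x_0^{d_s}` in the other slots. -/
def tensorG (i j : Fin r) (g : Matrix (Fin (n i)) (Fin (n j)) ℝ) : PSTensor n d :=
  ∑ k, ∑ l, g k l •
    simpleTensor (Function.update (Function.update (fun s => x0Pow (n s) (d s)) i (linMonomial k))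
      j (linMonomial l))

end Tensor

/-! ### The block matrix -/

/-- `√((d-1)/d)` times the matrix with diagonal entries `√2 f_{kk}` and off-diagonal entries
`f_{kl}`. -/
def diagBlock {n : ℕ} (d : ℕ) (f : Matrix (Fin n) (Fin n) ℝ) : Matrix (Fin n) (Fin n) ℝ :=
  √(((d : ℝ) - 1) / d) • Matrix.of fun k l => if k = l then √2 * f k k else f k l

/-- The block matrix with diagonal blocks `D i`, blocks `O i j` above the diagonal (`i < j`) and
their transposes below it. -/
def blockMatrix {r : ℕ} {n : Fin r → ℕ} (D : ∀ i, Matrix (Fin (n i)) (Fin (n i)) ℝ)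
    (O : ∀ i j, Matrix (Fin (n i)) (Fin (n j)) ℝ) :
    Matrix (Σ i, Fin (n i)) (Σ i, Fin (n i)) ℝ :=
  Matrix.blockDiagonal' D + Matrix.of fun p q =>
    if p.1 < q.1 then O p.1 q.1 p.2 q.2
    else if q.1 < p.1 then O q.1 p.1 q.2 p.2
    else 0

end

end SegreVeronese

/-! Every point of the manifold with positive inner product with E is a positive multiple of some
Φ(t) = ⊗ (x_0 + Σ_k (t_{ik}/√d_i) x_k)^{d_i}, since none of its linear forms can lose its x_0-term.
So near E the manifold is the radial projection to the sphere of the graph Φ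
(`isRadialGraph_segreVeronese`).

For any such radial graph the second fundamental form at the base point is the Hessian of Φ at 0
paired with the normal vector (`IsRadialGraph.inner_fderiv_tangentField`). The radial scaling and
the choice of the tangent field only produce multiples of E and tangent vectors, which the normal
vector annihilates.

By the multinomial theorem, the coordinate of Φ(t) at each orthonormal monomial tensor is a constant
times one monomial t^m (`inner_affineMonomial_affineParam`). Hence E carries order zero, the tangent
basis carries order one, and the tensors with affine exponent of degree two, which span W and G,
carry the Hessian. The second-order constant is 1 when the two variables lie in different slots.
Within slot i it is √((d_i-1)/d_i), divided by √2 for a square (`paramCoeff_pair_of_eq`). The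
Hessian of t_k² contributes a 2, and 2/√2 = √2 gives the diagonal entries.

The statements on the normal space are bookkeeping in the same family: distinct exponents are
orthogonal, so only exponents have to be compared. -/

namespace SegreVeronese

noncomputable section

/-! ### Submanifolds of the sphere that are radial graphs over a tangent space -/

section RadialGraph

variable {V : Type*} [NormedAddCommGroup V] [InnerProductSpace ℝ V]
variable {P : Type*} [NormedAddCommGroup P] [NormedSpace ℝ P]

/-- Near the unit vector `e`, the subset `M` of the unit sphere is the radial projection of the
graph `Φ` over the parameter space `P`, and `τ` is a linear left inverse of `Φ`. -/
structure IsRadialGraph (M : Set V) (e : V) (τ : V →L[ℝ] P) (Φ : P → V) : Prop where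
  contDiff : ContDiff ℝ ∞ Φ
  map_zero : Φ 0 = e
  inner_eq_one : ∀ t, ⟪e, Φ t⟫_ℝ = 1
  left_inv : ∀ t, τ (Φ t) = t
  normalize_mem : ∀ t, ‖Φ t‖⁻¹ • Φ t ∈ M
  eq_of_mem : ∀ u ∈ M, 0 < ⟪e, u⟫_ℝ → u = ⟪e, u⟫_ℝ • Φ ((⟪e, u⟫_ℝ)⁻¹ • τ u)
  norm_eq_one : ∀ u ∈ M, ‖u‖ = 1

/-- Tangent vectors of a subset of the unit sphere are orthogonal to the position vector. -/
theorem inner_eq_zero_of_mem_tangentSpace {M : Set V} (hM : ∀ u ∈ M, ‖u‖ = 1) {u y : V}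
    (hy : y ∈ tangentSpace M u) : ⟪u, y⟫_ℝ = 0 := by
  induction hy using Submodule.span_induction with
  | mem y hy =>
    obtain ⟨γ, hγ, hγM, rfl, rfl⟩ := hy
    have hd : HasDerivAt γ (deriv γ 0) 0 :=
      ((hγ.differentiable (by simp)).differentiableAt).hasDerivAt
    have h1 := hd.inner ℝ hd
    have h2 : (fun t => ⟪γ t, γ t⟫_ℝ) = fun _ => (1 : ℝ) := by
      funext t
      rw [real_inner_self_eq_norm_sq, hM _ (hγM t), one_pow]
    rw [h2] at h1
    have h3 := h1.unique (hasDerivAt_const (0 : ℝ) (1 : ℝ))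
    rw [real_inner_comm (γ 0) (deriv γ 0)] at h3
    linarith
  | zero => simp
  | add x y _ _ hx hy => rw [inner_add_right, hx, hy, add_zero]
  | smul c x _ hx => rw [inner_smul_right, hx, mul_zero]

/-! ### First-order geometry of a radial graph. -/

namespace IsRadialGraph

variable {M : Set V} {e : V} {τ : V →L[ℝ] P} {Φ : P → V}

theorem ne_zero (h : IsRadialGraph M e τ Φ) (t : P) : Φ t ≠ 0 := fun h0 => by
  have := h.inner_eq_one t
  simp [h0] at this

theorem hasFDerivAt (h : IsRadialGraph M e τ Φ) (t : P) : HasFDerivAt Φ (fderiv ℝ Φ t) t :=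
  ((h.contDiff.differentiable (by simp)).differentiableAt).hasFDerivAt

theorem map_base (h : IsRadialGraph M e τ Φ) : τ e = 0 := by
  rw [← h.map_zero, h.left_inv]

theorem inner_base (h : IsRadialGraph M e τ Φ) : ⟪e, e⟫_ℝ = 1 := by
  have := h.inner_eq_one 0
  rwa [h.map_zero] at this

theorem norm_base (h : IsRadialGraph M e τ Φ) : ‖e‖ = 1 := by
  have := h.inner_base
  rw [real_inner_self_eq_norm_sq] at this
  exact (pow_eq_one_iff_of_nonneg (norm_nonneg _) two_ne_zero).1 this

/-- Differentiate u = ⟪e,u⟫ Φ(⟪e,u⟫⁻¹ τ u) along a curve in M; positivity of ⟪e,u⟫ is an open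
condition, so the identity holds near time 0. The result is linear in y and passes to the span.
Having it at all nearby points, not only at e, is what allows an arbitrary tangent field to be
differentiated later. -/
theorem tangent_eq (h : IsRadialGraph M e τ Φ) {u y : V} (hu : 0 < ⟪e, u⟫_ℝ)
    (hy : y ∈ tangentSpace M u) :
    y = ⟪e, y⟫_ℝ • Φ ((⟪e, u⟫_ℝ)⁻¹ • τ u) +
      fderiv ℝ Φ ((⟪e, u⟫_ℝ)⁻¹ • τ u) (τ y - ⟪e, y⟫_ℝ • (⟪e, u⟫_ℝ)⁻¹ • τ u) := by
  induction hy using Submodule.span_induction with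
  | mem y hy =>
    obtain ⟨γ, hγ, hγM, rfl, rfl⟩ := hy
    have hd : HasDerivAt γ (deriv γ 0) 0 :=
      ((hγ.differentiable (by simp)).differentiableAt).hasDerivAt
    have hin : HasDerivAt (fun s => ⟪e, γ s⟫_ℝ) ⟪e, deriv γ 0⟫_ℝ 0 := by
      simpa using (hasDerivAt_const (0 : ℝ) e).inner ℝ hd
    have hτ : HasDerivAt (fun s => τ (γ s)) (τ (deriv γ 0)) 0 :=
      τ.hasFDerivAt.comp_hasDerivAt _ hd
    have hin' := hin.inv hu.ne'
    have ht := hin'.smul hτ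
    have hΦ := (h.hasFDerivAt ((⟪e, γ 0⟫_ℝ)⁻¹ • τ (γ 0))).comp_hasDerivAt_of_eq 0 ht rfl
    have hall := hin.smul hΦ
    have hev : γ =ᶠ[nhds 0] fun s => ⟪e, γ s⟫_ℝ • Φ ((⟪e, γ s⟫_ℝ)⁻¹ • τ (γ s)) := by
      filter_upwards [hin.continuousAt.eventually (lt_mem_nhds hu)] with s hs
      exact h.eq_of_mem _ (hγM s) hs
    have huniq := hd.unique (hall.congr_of_eventuallyEq hev)
    conv_lhs => rw [huniq]
    rw [add_comm]
    simp only [Function.comp, Pi.smul_apply', Pi.inv_apply]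
    congr 1
    rw [← map_smul]
    congr 1
    have h0 : ⟪e, γ 0⟫_ℝ ≠ 0 := hu.ne'
    rw [smul_add, smul_smul, smul_smul, smul_smul, mul_inv_cancel₀ h0, one_smul, sub_eq_add_neg,
      ← neg_smul]
    congr 2
    field_simp
  | zero => simp
  | add x y _ _ hx hy =>
    conv_lhs => rw [hx, hy]
    rw [inner_add_right, map_add, add_smul, add_smul]
    simp only [map_sub, map_add]
    abel
  | smul c x _ hx =>
    conv_lhs => rw [hx]
    rw [inner_smul_right, map_smul]
    simp only [map_sub, map_smul, smul_add, smul_sub, smul_smul, mul_assoc]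

/-- The radial projection of the graph to the unit sphere. -/
def param (Φ : P → V) (t : P) : V := ‖Φ t‖⁻¹ • Φ t

theorem contDiff_param (h : IsRadialGraph M e τ Φ) : ContDiff ℝ ∞ (param Φ) :=
  ((h.contDiff.norm ℝ h.ne_zero).inv fun t => norm_ne_zero_iff.2 (h.ne_zero t)).smul h.contDiff

theorem hasFDerivAt_param (h : IsRadialGraph M e τ Φ) (t : P) :
    HasFDerivAt (param Φ) (fderiv ℝ (param Φ) t) t :=
  ((h.contDiff_param.differentiable (by simp)).differentiableAt).hasFDerivAt

theorem param_zero (h : IsRadialGraph M e τ Φ) : param Φ 0 = e := by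
  rw [param, h.map_zero, h.norm_base, inv_one, one_smul]

theorem map_param (h : IsRadialGraph M e τ Φ) (t : P) : τ (param Φ t) = ‖Φ t‖⁻¹ • t := by
  rw [param, map_smul, h.left_inv]

theorem inner_param (h : IsRadialGraph M e τ Φ) (t : P) : ⟪e, param Φ t⟫_ℝ = ‖Φ t‖⁻¹ := by
  rw [param, inner_smul_right, h.inner_eq_one, mul_one]

theorem inner_param_pos (h : IsRadialGraph M e τ Φ) (t : P) : 0 < ⟪e, param Φ t⟫_ℝ := by
  rw [h.inner_param]
  exact inv_pos.2 (norm_pos_iff.2 (h.ne_zero t))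

theorem coord_param (h : IsRadialGraph M e τ Φ) (t : P) :
    (⟪e, param Φ t⟫_ℝ)⁻¹ • τ (param Φ t) = t := by
  rw [h.map_param, h.inner_param, inv_inv, smul_smul,
    mul_inv_cancel₀ (norm_ne_zero_iff.2 (h.ne_zero t)), one_smul]

/-- The unit norm of u forces ⟪e,u⟫ to be the inverse of the norm of the graph point, so normalizing
recovers u itself. -/
theorem param_coord (h : IsRadialGraph M e τ Φ) {u : V} (hu : u ∈ M) (hpos : 0 < ⟪e, u⟫_ℝ) :
    param Φ ((⟪e, u⟫_ℝ)⁻¹ • τ u) = u := by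
  have h1 := h.eq_of_mem u hu hpos
  have h2 := h.norm_eq_one u hu
  rw [h1, norm_smul, Real.norm_of_nonneg hpos.le] at h2
  rw [param, ← eq_inv_of_mul_eq_one_left h2]
  exact h1.symm

theorem fderiv_param_mem (h : IsRadialGraph M e τ Φ) (t v : P) :
    fderiv ℝ (param Φ) t v ∈ tangentSpace M (param Φ t) := by
  refine Submodule.subset_span ⟨fun s => param Φ (t + s • v), ?_, fun s => h.normalize_mem _,
    by simp, ?_⟩
  · exact h.contDiff_param.comp (contDiff_const.add (contDiff_id.smul contDiff_const))
  · have hl : HasDerivAt (fun s : ℝ => t + s • v) v 0 := by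
      simpa using ((hasDerivAt_id (0 : ℝ)).smul_const v).const_add t
    exact ((h.hasFDerivAt_param t).comp_hasDerivAt_of_eq 0 hl (by simp)).deriv

/-- This is `tangent_eq` at e, where both τ e and ⟪e,y⟫ vanish. -/
theorem fderiv_map_eq_self (h : IsRadialGraph M e τ Φ) {y : V} (hy : y ∈ tangentSpace M e) :
    fderiv ℝ Φ 0 (τ y) = y := by
  have h1 := h.tangent_eq (by rw [h.inner_base]; exact one_pos) hy
  rw [inner_eq_zero_of_mem_tangentSpace h.norm_eq_one hy, h.map_base] at h1
  simpa using h1.symm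

/-- The derivative of the norm need not be computed: the left side is tangent at e, hence determined
by its image under τ. In τ-coordinates the curve is ‖Φ(s v)‖⁻¹ s v, and the factor s kills the
derivative of the scalar at s = 0. -/
theorem fderiv_param_zero (h : IsRadialGraph M e τ Φ) (v : P) :
    fderiv ℝ (param Φ) 0 v = fderiv ℝ Φ 0 v := by
  have hm := h.fderiv_param_mem 0 v
  rw [h.param_zero] at hm
  rw [← h.fderiv_map_eq_self hm]
  congr 1
  have hl : HasDerivAt (fun s : ℝ => s • v) v 0 := by
    simpa using (hasDerivAt_id (0 : ℝ)).smul_const v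
  have h1 := τ.hasFDerivAt.comp_hasDerivAt 0
    ((h.hasFDerivAt_param 0).comp_hasDerivAt_of_eq 0 hl (by simp))
  have h2 : (⇑τ ∘ param Φ ∘ fun s : ℝ => s • v) = fun s : ℝ => ‖Φ (s • v)‖⁻¹ • s • v := by
    funext s
    exact h.map_param _
  have h3 : DifferentiableAt ℝ (fun s : ℝ => ‖Φ (s • v)‖⁻¹) 0 := by
    have : ContDiff ℝ ∞ fun s : ℝ => ‖Φ (s • v)‖⁻¹ :=
      ((h.contDiff.norm ℝ h.ne_zero).inv fun t => norm_ne_zero_iff.2 (h.ne_zero t)).comp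
        (contDiff_id.smul contDiff_const)
    exact (this.differentiable (by simp)).differentiableAt
  have h4 := h3.hasDerivAt.smul hl
  rw [h2] at h1
  have h5 := h1.unique h4
  simpa [h.map_zero, h.norm_base] using h5

theorem tangentSpace_eq (h : IsRadialGraph M e τ Φ) :
    tangentSpace M e = LinearMap.range (fderiv ℝ Φ 0 : P →ₗ[ℝ] V) := by
  apply le_antisymm
  · intro y hy
    exact ⟨τ y, h.fderiv_map_eq_self hy⟩
  · rintro _ ⟨v, rfl⟩
    have hm := h.fderiv_param_mem 0 v
    rwa [h.param_zero, h.fderiv_param_zero] at hm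

/-- The constant field τ v on the parameter space is pushed forward by `param`, and extended to the
open half-space ⟪e,u⟫ > 0 through the ambient coordinate ⟪e,u⟫⁻¹ τ u. -/
theorem exists_tangentField (h : IsRadialGraph M e τ Φ) {v : V} (hv : v ∈ tangentSpace M e) :
    ∃ Y : V → V, IsLocalTangentField M e Y ∧ Y e = v := by
  refine ⟨fun u => fderiv ℝ (param Φ) ((⟪e, u⟫_ℝ)⁻¹ • τ u) (τ v),
    ⟨{u | 0 < ⟪e, u⟫_ℝ}, ?_, ?_, ?_, ?_⟩, ?_⟩
  · exact isOpen_lt continuous_const (continuous_const.inner continuous_id)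
  · change 0 < ⟪e, e⟫_ℝ
    rw [h.inner_base]
    exact one_pos
  · have h1 : ContDiff ℝ ∞ (fderiv ℝ (param Φ)) := h.contDiff_param.fderiv_right (by simp)
    refine (h1.comp_contDiffOn (ContDiffOn.smul (ContDiffOn.inv
      (contDiff_const.inner ℝ contDiff_id).contDiffOn fun u (hu : 0 < ⟪e, u⟫_ℝ) => hu.ne')
      τ.contDiff.contDiffOn)).clm_apply contDiffOn_const
  · rintro u ⟨hpos, hu⟩
    have hm := h.fderiv_param_mem ((⟪e, u⟫_ℝ)⁻¹ • τ u) (τ v)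
    rwa [h.param_coord hu hpos] at hm
  · change fderiv ℝ (param Φ) ((⟪e, e⟫_ℝ)⁻¹ • τ e) (τ v) = v
    rw [h.map_base, smul_zero, h.fderiv_param_zero, h.fderiv_map_eq_self hv]

/-! ### The second fundamental form of a radial graph. -/

theorem inner_eq_zero_of_mem_normalSpace {a : V} (ha : a ∈ normalSpace M e) :
    ⟪e, a⟫_ℝ = 0 ∧ ∀ y ∈ tangentSpace M e, ⟪y, a⟫_ℝ = 0 :=
  ⟨(Submodule.mem_orthogonal _ _).1 ha _ (Submodule.mem_sup_right
    (Submodule.mem_span_singleton_self e)),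
    fun _ hy => (Submodule.mem_orthogonal _ _).1 ha _ (Submodule.mem_sup_left hy)⟩

/-- Restrict Y to the curve s ↦ `param Φ (s • τ w)` and rewrite its values by `tangent_eq`.
Differentiating at 0 leaves a multiple of e, vectors in the range of DΦ(0), and the Hessian term;
only the last survives pairing with a normal vector. This also shows independence of the field. -/
theorem inner_fderiv_tangentField (h : IsRadialGraph M e τ Φ) {v w a : V}
    (hv : v ∈ tangentSpace M e) (hw : w ∈ tangentSpace M e) (ha : a ∈ normalSpace M e)
    {Y : V → V} (hY : IsLocalTangentField M e Y) (hYv : Y e = v) :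
    ⟪fderiv ℝ Y e w, a⟫_ℝ = ⟪fderiv ℝ (fderiv ℝ Φ) 0 (τ w) (τ v), a⟫_ℝ := by
  obtain ⟨U, hU, heU, hYU, hYT⟩ := hY
  obtain ⟨hea, hTa⟩ := inner_eq_zero_of_mem_normalSpace ha
  have hl : HasDerivAt (fun s : ℝ => s • τ w) (τ w) 0 := by
    simpa using (hasDerivAt_id (0 : ℝ)).smul_const (τ w)
  have hγ : HasDerivAt (fun s : ℝ => param Φ (s • τ w)) w 0 := by
    have := (h.hasFDerivAt_param 0).comp_hasDerivAt_of_eq 0 hl (by simp)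
    rwa [h.fderiv_param_zero, h.fderiv_map_eq_self hw] at this
  have hYd : HasFDerivAt Y (fderiv ℝ Y e) e :=
    ((hYU.contDiffAt (hU.mem_nhds heU)).differentiableAt (by simp)).hasFDerivAt
  have hYγ : HasDerivAt (fun s : ℝ => Y (param Φ (s • τ w))) (fderiv ℝ Y e w) 0 :=
    hYd.comp_hasDerivAt_of_eq 0 hγ (by simp [h.param_zero])
  set y : ℝ → V := fun s => Y (param Φ (s • τ w)) with hy
  have hy0 : y 0 = v := by simp [hy, h.param_zero, hYv]
  have hyin : HasDerivAt (fun s => ⟪e, y s⟫_ℝ) ⟪e, fderiv ℝ Y e w⟫_ℝ 0 := by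
    simpa using (hasDerivAt_const (0 : ℝ) e).inner ℝ hYγ
  have hyτ : HasDerivAt (fun s => τ (y s)) (τ (fderiv ℝ Y e w)) 0 :=
    τ.hasFDerivAt.comp_hasDerivAt _ hYγ
  have hΦ : HasDerivAt (fun s : ℝ => Φ (s • τ w)) (fderiv ℝ Φ 0 (τ w)) 0 :=
    (h.hasFDerivAt 0).comp_hasDerivAt_of_eq 0 hl (by simp)
  have hΦ' : HasDerivAt (fun s : ℝ => fderiv ℝ Φ (s • τ w)) (fderiv ℝ (fderiv ℝ Φ) 0 (τ w)) 0 := by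
    have h1 : ContDiff ℝ ∞ (fderiv ℝ Φ) := h.contDiff.fderiv_right (by simp)
    exact ((h1.differentiable (by simp)).differentiableAt.hasFDerivAt).comp_hasDerivAt_of_eq 0 hl
      (by simp)
  have hrhs := (hyin.smul hΦ).add (hΦ'.clm_apply (hyτ.sub (hyin.smul hl)))
  have hev : (fun s => y s) =ᶠ[nhds 0] fun s => ⟪e, y s⟫_ℝ • Φ (s • τ w) +
      fderiv ℝ Φ (s • τ w) (τ (y s) - ⟪e, y s⟫_ℝ • s • τ w) := by
    have hUe : ∀ᶠ s : ℝ in nhds 0, param Φ (s • τ w) ∈ U :=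
      hγ.continuousAt.eventually (hU.mem_nhds (by simpa [h.param_zero] using heU))
    filter_upwards [hUe] with s hs
    have := h.tangent_eq (h.inner_param_pos (s • τ w)) (hYT _ ⟨hs, h.normalize_mem _⟩)
    rwa [h.coord_param] at this
  have huniq := hYγ.unique (hrhs.congr_of_eventuallyEq hev)
  -- This is the value at 0 of the coefficient of Φ. It also removes the radial correction from the
  -- argument of the Hessian.
  have hvin : ⟪e, v⟫_ℝ = 0 := inner_eq_zero_of_mem_tangentSpace h.norm_eq_one hv
  have hT : ∀ p, ⟪fderiv ℝ Φ 0 p, a⟫_ℝ = 0 := fun p =>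
    hTa _ (by rw [h.tangentSpace_eq]; exact ⟨p, rfl⟩)
  rw [huniq]
  simp only [hy0, hvin, zero_smul, h.map_zero, inner_add_left, hT, inner_smul_left, hea, mul_zero]
  simp [hy0]

/-- The second fundamental form of a radial graph, in terms of the Hessian of `Φ`. -/
def secondForm (M : Set V) (e : V) (τ : V →L[ℝ] P) (Φ : P → V) :
    tangentSpace M e →ₗ[ℝ] tangentSpace M e →ₗ[ℝ] normalSpace M e →ₗ[ℝ] ℝ :=
  LinearMap.mk₂ ℝ
    (fun v w => (innerₗ V (fderiv ℝ (fderiv ℝ Φ) 0 (τ w) (τ v))).comp (normalSpace M e).subtype)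
    (fun v v' w => by ext; simp)
    (fun c v w => by ext; simp)
    (fun v w w' => by ext; simp)
    (fun c v w => by ext; simp)

theorem secondForm_apply (v w : tangentSpace M e) (a : normalSpace M e) :
    secondForm M e τ Φ v w a = ⟪fderiv ℝ (fderiv ℝ Φ) 0 (τ w) (τ v), (a : V)⟫_ℝ := rfl

theorem isSecondFundamentalForm (h : IsRadialGraph M e τ Φ) :
    IsSecondFundamentalForm M e (secondForm M e τ Φ) where
  exists_field v := h.exists_tangentField v.2
  apply_eq v w a _ hY hYv := (h.inner_fderiv_tangentField v.2 w.2 a.2 hY hYv).symm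

end IsRadialGraph

/-! ### Uniqueness of the second fundamental form and of the Weingarten map. -/

theorem IsSecondFundamentalForm.unique {M : Set V} {x : V}
    {II II' : tangentSpace M x →ₗ[ℝ] tangentSpace M x →ₗ[ℝ] normalSpace M x →ₗ[ℝ] ℝ}
    (h : IsSecondFundamentalForm M x II) (h' : IsSecondFundamentalForm M x II') : II = II' := by
  ext v w a
  obtain ⟨Y, hY, hYv⟩ := h.exists_field v
  rw [h.apply_eq v w a Y hY hYv, h'.apply_eq v w a Y hY hYv]

theorem IsWeingartenMap.unique {M : Set V} {x : V} {a : normalSpace M x}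
    {L L' : tangentSpace M x →ₗ[ℝ] tangentSpace M x}
    (h : IsWeingartenMap M x a L) (h' : IsWeingartenMap M x a L') : L = L' := by
  obtain ⟨II, hII, hL⟩ := h
  obtain ⟨II', hII', hL'⟩ := h'
  obtain rfl := hII.unique hII'
  ext1 w
  exact ext_inner_left ℝ fun v => by rw [← hL, ← hL']

/-- A second fundamental form determines a Weingarten map. -/
theorem IsSecondFundamentalForm.isWeingartenMap {M : Set V} {x : V}
    [FiniteDimensional ℝ (tangentSpace M x)]
    {II : tangentSpace M x →ₗ[ℝ] tangentSpace M x →ₗ[ℝ] normalSpace M x →ₗ[ℝ] ℝ}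
    (h : IsSecondFundamentalForm M x II) {ι : Type*} [Fintype ι] [DecidableEq ι]
    (b : OrthonormalBasis ι ℝ (tangentSpace M x)) (a : normalSpace M x) :
    IsWeingartenMap M x a
      (Matrix.toLin b.toBasis b.toBasis (Matrix.of fun p q => II (b p) (b q) a)) := by
  refine ⟨II, h, fun v w => ?_⟩
  set L := Matrix.toLin b.toBasis b.toBasis (Matrix.of fun p q => II (b p) (b q) a)
  -- Both sides are bilinear in (v, w), so it suffices to test them on pairs of basis vectors. The
  -- two flips cancel.
  suffices hB : (LinearMap.flip II).flip.compr₂ (LinearMap.applyₗ a) =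
      (innerₗ (tangentSpace M x)).compl₂ L from LinearMap.congr_fun₂ hB v w
  refine b.toBasis.ext fun p => b.toBasis.ext fun q => ?_
  have hLq : L (b q) = ∑ p, II (b p) (b q) a • b p := by
    have := Matrix.toLin_self b.toBasis b.toBasis (Matrix.of fun p q => II (b p) (b q) a) q
    simpa using this
  simp [hLq, b.inner_eq_ite]

end RadialGraph

/-! ### Tensors of powers of linear forms -/

/-- The power `(∑ a_k x_k)^d` in `H_{n,d}`. -/
def powerPoly {n : ℕ} (d : ℕ) (a : Fin (n + 1) → ℝ) : HomPoly n d :=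
  ⟨(∑ k, a k • X k) ^ d, by
    rw [mem_homogeneousSubmodule]
    have h : (∑ k, a k • X k : MvPolynomial (Fin (n + 1)) ℝ).IsHomogeneous 1 :=
      (mem_homogeneousSubmodule 1 _).1
        (Submodule.sum_mem _ fun k _ => Submodule.smul_mem _ _
          ((mem_homogeneousSubmodule 1 _).2 (isHomogeneous_X _ _)))
    simpa using h.pow d⟩

theorem monomialBasis_repr (n d : ℕ) (f : HomPoly n d) (α : MultiIndex n d) :
    (monomialBasis n d).repr f α =
      coeff α.1 (f : MvPolynomial (Fin (n + 1)) ℝ) / √(α.1.multinomial : ℝ) := rfl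

/-- The multinomial theorem gives the coefficient with the full multinomial; dividing by the scaling
of the monomial leaves its square root. -/
theorem monomialBasis_repr_powerPoly {n d : ℕ} (a : Fin (n + 1) → ℝ) (α : MultiIndex n d) :
    (monomialBasis n d).repr (powerPoly d a) α =
      √(α.1.multinomial : ℝ) * ∏ k, a k ^ α.1 k := by
  rw [monomialBasis_repr, powerPoly, coeff_linearCombination_X_pow_of_fintype, if_pos,
    Finsupp.prod_fintype _ _ fun i => pow_zero _, mul_div_right_comm, Real.div_sqrt]
  rw [Finsupp.sum_fintype _ _ fun i => rfl, ← Finsupp.degree_eq_sum, α.2]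

theorem powerPoly_smul {n d : ℕ} (c : ℝ) (a : Fin (n + 1) → ℝ) :
    powerPoly d (c • a) = c ^ d • powerPoly d a := by
  apply Subtype.ext
  simp [powerPoly, mul_smul, ← Finset.smul_sum, smul_pow]

theorem exists_eq_single_add {σ : Type*} {m : σ →₀ ℕ} {c : ℕ} (h : m.degree = c + 1) :
    ∃ (p : σ) (g : σ →₀ ℕ), m = Finsupp.single p 1 + g ∧ g.degree = c := by
  have h0 : m ≠ 0 := by
    rintro rfl
    simp at h
  obtain ⟨p, hp⟩ := Finsupp.ne_iff.1 h0
  have hle : Finsupp.single p 1 ≤ m := Finsupp.single_le_iff.2 (Nat.one_le_iff_ne_zero.2 hp)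
  have hm := (add_tsub_cancel_of_le hle).symm
  refine ⟨p, m - Finsupp.single p 1, hm, ?_⟩
  rw [hm, map_add, Finsupp.degree_single] at h
  lia

/-- The sign in the cone is absorbed into σ, which can stay an arbitrary real number because only
its product with later factors is used. -/
theorem exists_eq_powerPoly_of_mem_veroneseCone {n d : ℕ} {f : HomPoly n d}
    (hf : f ∈ veroneseCone n d) : ∃ (σ : ℝ) (a : Fin (n + 1) → ℝ), f = σ • powerPoly d a := by
  obtain ⟨ℓ, hℓ, h⟩ := hf
  have hℓ' : ℓ = ∑ k, coeff (Finsupp.single k 1) ℓ • X k := by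
    ext β
    simp only [coeff_sum, coeff_smul, coeff_X, smul_eq_mul, mul_ite, mul_one, mul_zero]
    by_cases hβ : β.degree = 1
    · obtain ⟨k, rfl⟩ := show ∃ k, β = Finsupp.single k 1 by
        obtain ⟨k, g, rfl, hg⟩ := exists_eq_single_add (c := 0) hβ
        exact ⟨k, by rw [(Finsupp.degree_eq_zero_iff g).1 hg, add_zero]⟩
      rw [Finset.sum_eq_single k]
      · simp
      · intro l _ hl
        rw [if_neg]
        exact fun h => hl (Finsupp.single_left_injective one_ne_zero h)
      · simp
    · rw [((mem_homogeneousSubmodule 1 _).1 hℓ).coeff_eq_zero hβ, Finset.sum_eq_zero]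
      intro k _
      rw [if_neg]
      rintro rfl
      simp at hβ
  rcases h with h | h
  · refine ⟨1, fun k => coeff (Finsupp.single k 1) ℓ, Subtype.ext ?_⟩
    rw [one_smul, h]
    exact congrArg (· ^ d) hℓ'
  · refine ⟨-1, fun k => coeff (Finsupp.single k 1) ℓ, Subtype.ext ?_⟩
    rw [h, Submodule.coe_smul, neg_smul, one_smul]
    exact congrArg (fun x => -x ^ d) hℓ'

theorem powerPoly_mem_veroneseCone {n d : ℕ} (a : Fin (n + 1) → ℝ) :
    powerPoly d a ∈ veroneseCone n d := by
  refine ⟨powerPoly 1 a, (powerPoly 1 a).2, Or.inl ?_⟩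
  simp [powerPoly]

variable {r : ℕ} {n d : Fin r → ℕ}

/-- The tensor `ℓ_1^{d_1} ⊗ ⋯ ⊗ ℓ_r^{d_r}` with `ℓ_i = ∑ a_{ik} x_k`. -/
def powerTensor (d : Fin r → ℕ) (a : ∀ i, Fin (n i + 1) → ℝ) : PSTensor n d :=
  simpleTensor fun i => powerPoly (d i) (a i)

theorem simpleTensor_smul (c : Fin r → ℝ) (f : ∀ i, HomPoly (n i) (d i)) :
    simpleTensor (fun i => c i • f i) = (∏ i, c i) • simpleTensor f :=
  MultilinearMap.map_smul_univ (PiTensorProduct.tprod ℝ) c f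

theorem powerTensor_smul (c : Fin r → ℝ) (a : ∀ i, Fin (n i + 1) → ℝ) :
    powerTensor d (fun i => c i • a i) = (∏ i, c i ^ d i) • powerTensor d a := by
  rw [powerTensor, powerTensor, ← simpleTensor_smul]
  simp only [powerPoly_smul]

theorem tensorBasis_repr_simpleTensor (f : ∀ i, HomPoly (n i) (d i))
    (α : ∀ i, MultiIndex (n i) (d i)) :
    (tensorBasis n d).repr (simpleTensor f) α =
      ∏ i, (monomialBasis (n i) (d i)).repr (f i) (α i) :=
  Basis.piTensorProduct_repr_tprod_apply _ _ _

theorem tensorBasis_repr_powerTensor (a : ∀ i, Fin (n i + 1) → ℝ)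
    (α : ∀ i, MultiIndex (n i) (d i)) :
    (tensorBasis n d).repr (powerTensor d a) α =
      ∏ i, (√((α i).1.multinomial : ℝ) * ∏ k, a i k ^ (α i).1 k) := by
  rw [powerTensor, tensorBasis_repr_simpleTensor]
  simp only [monomialBasis_repr_powerPoly]

theorem inner_eq_sum (F G : PSTensor n d) :
    ⟪F, G⟫_ℝ = ∑ α, (tensorBasis n d).repr F α * (tensorBasis n d).repr G α := rfl

theorem inner_tensorBasis (α : ∀ i, MultiIndex (n i) (d i)) (F : PSTensor n d) :
    ⟪tensorBasis n d α, F⟫_ℝ = (tensorBasis n d).repr F α := by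
  classical
  rw [inner_eq_sum, Finset.sum_eq_single α]
  · simp
  · intro β _ hβ
    simp [hβ.symm]
  · simp

instance : FiniteDimensional ℝ (PSTensor n d) := Module.Finite.of_basis (tensorBasis n d)

theorem exists_eq_powerTensor_of_mem_segreVeronese {F : PSTensor n d}
    (hF : F ∈ segreVeronese n d) :
    ∃ (σ : ℝ) (a : ∀ i, Fin (n i + 1) → ℝ), F = σ • powerTensor d a := by
  obtain ⟨⟨f, hf, rfl⟩, -⟩ := hF
  choose σ a h using fun i => exists_eq_powerPoly_of_mem_veroneseCone (hf i)
  refine ⟨∏ i, σ i, a, ?_⟩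
  rw [powerTensor, ← simpleTensor_smul]
  exact congrArg simpleTensor (funext h)

/-- A positive multiple of a tensor of powers lies on the manifold if it has norm `1`. -/
theorem smul_powerTensor_mem_segreVeronese (hd : ∀ i, 1 ≤ d i) (i : Fin r) {c : ℝ} (hc : 0 ≤ c)
    (a : ∀ i, Fin (n i + 1) → ℝ) (h : ‖c • powerTensor d a‖ = 1) :
    c • powerTensor d a ∈ segreVeronese n d := by
  classical
  -- The factor c ≥ 0 is absorbed by one slot: scaling its linear form by c^(1/d_i) scales the
  -- tensor by c.
  refine ⟨⟨fun j => powerPoly (d j) (Function.update (fun _ => (1 : ℝ)) i (c ^ ((d i : ℝ)⁻¹)) j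
    • a j), fun j => powerPoly_mem_veroneseCone _, ?_⟩, by simpa using h⟩
  change _ = powerTensor d _
  rw [powerTensor_smul, Finset.prod_eq_single i]
  · rw [Function.update_self, Real.rpow_inv_natCast_pow hc]
    have := hd i
    lia
  · intro j _ hj
    rw [Function.update_of_ne hj, one_pow]
  · simp

/-! ### Monomial tensors indexed by exponents of the affine variables -/

variable (n d) in
/-- The exponent vectors of homogeneity degrees `d_i` whose exponents at the variables
`x_{i,k}`, `k ≥ 1`, are given by `m`. -/
def homExponent (m : (Σ i, Fin (n i)) →₀ ℕ) (i : Fin r) : Fin (n i + 1) →₀ ℕ :=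
  Finsupp.equivFunOnFinite.symm (Fin.cons (d i - ∑ k, m ⟨i, k⟩) fun k => m ⟨i, k⟩)

@[simp]
theorem homExponent_zero (m : (Σ i, Fin (n i)) →₀ ℕ) (i : Fin r) :
    homExponent n d m i 0 = d i - ∑ k, m ⟨i, k⟩ := rfl

@[simp]
theorem homExponent_succ (m : (Σ i, Fin (n i)) →₀ ℕ) (i : Fin r) (k : Fin (n i)) :
    homExponent n d m i k.succ = m ⟨i, k⟩ := rfl

/-- When the affine exponents exceed d_i, the truncated subtraction puts 0 at x_0 and the degree is
too large. Thus the degree test in `scaledMonomial` detects admissibility. -/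
theorem degree_homExponent (m : (Σ i, Fin (n i)) →₀ ℕ) (i : Fin r) :
    (homExponent n d m i).degree = d i ↔ ∑ k, m ⟨i, k⟩ ≤ d i := by
  rw [Finsupp.degree_eq_sum, Fin.sum_univ_succ]
  simp only [homExponent_zero, homExponent_succ]
  lia

variable (d) in
/-- The exponents of the affine variables that occur in a tensor of multidegree `d`. -/
def IsAdmissible (m : (Σ i, Fin (n i)) →₀ ℕ) : Prop := ∀ i, ∑ k, m ⟨i, k⟩ ≤ d i

variable (n d) in
/-- The tensor of scaled monomials with affine exponents `m`; it vanishes if `m` is not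
admissible. -/
def affineMonomial (m : (Σ i, Fin (n i)) →₀ ℕ) : PSTensor n d :=
  simpleTensor fun i => scaledMonomial (homExponent n d m i)

/-- The index of the basis tensor with given admissible affine exponents. -/
def basisIndex (m : (Σ i, Fin (n i)) →₀ ℕ) (hm : IsAdmissible d m) (i : Fin r) :
    MultiIndex (n i) (d i) :=
  ⟨homExponent n d m i, (degree_homExponent m i).2 (hm i)⟩

theorem affineMonomial_eq_tensorBasis {m : (Σ i, Fin (n i)) →₀ ℕ} (hm : IsAdmissible d m) :
    affineMonomial n d m = tensorBasis n d (basisIndex m hm) :=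
  (tensorBasis_apply n d (basisIndex m hm)).symm

/-- One slot holds the default value 0 of `scaledMonomial`. This convention lets slots with d_i = 1
share formulas with the others. -/
theorem affineMonomial_eq_zero {m : (Σ i, Fin (n i)) →₀ ℕ} (hm : ¬ IsAdmissible d m) :
    affineMonomial n d m = 0 := by
  obtain ⟨i, hi⟩ := not_forall.1 hm
  refine MultilinearMap.map_coord_zero (PiTensorProduct.tprod ℝ) i ?_
  rw [scaledMonomial, dif_neg]
  rwa [degree_homExponent]

/-- The exponents of the affine variables. -/
def affineExponent (α : ∀ i, MultiIndex (n i) (d i)) : (Σ i, Fin (n i)) →₀ ℕ :=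
  Finsupp.equivFunOnFinite.symm fun p => (α p.1).1 p.2.succ

theorem zero_add_sum_affineExponent (α : ∀ i, MultiIndex (n i) (d i)) (i : Fin r) :
    (α i).1 0 + ∑ k, affineExponent α ⟨i, k⟩ = d i := by
  have h := (α i).2
  rwa [Finsupp.degree_eq_sum, Fin.sum_univ_succ] at h

theorem isAdmissible_affineExponent (α : ∀ i, MultiIndex (n i) (d i)) :
    IsAdmissible d (affineExponent α) := fun i => by
  have := zero_add_sum_affineExponent α i
  lia

theorem homExponent_affineExponent (α : ∀ i, MultiIndex (n i) (d i)) (i : Fin r) :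
    homExponent n d (affineExponent α) i = (α i).1 := by
  ext k
  refine Fin.cases ?_ (fun k => ?_) k
  · have := zero_add_sum_affineExponent α i
    rw [homExponent_zero]
    lia
  · rfl

theorem affineMonomial_affineExponent (α : ∀ i, MultiIndex (n i) (d i)) :
    affineMonomial n d (affineExponent α) = tensorBasis n d α := by
  rw [affineMonomial, tensorBasis_apply]
  simp only [homExponent_affineExponent]

theorem affineExponent_basisIndex (m : (Σ i, Fin (n i)) →₀ ℕ) (hm : IsAdmissible d m) :
    affineExponent (basisIndex m hm) = m := by
  ext p
  rfl

open Classical in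
theorem inner_affineMonomial (m m' : (Σ i, Fin (n i)) →₀ ℕ) :
    ⟪affineMonomial n d m, affineMonomial n d m'⟫_ℝ =
      if m = m' ∧ IsAdmissible d m then 1 else 0 := by
  by_cases hm : IsAdmissible d m
  · by_cases hm' : IsAdmissible d m'
    · rw [affineMonomial_eq_tensorBasis hm, affineMonomial_eq_tensorBasis hm', inner_tensorBasis,
        Basis.repr_self, Finsupp.single_apply]
      refine if_congr ⟨fun h => ⟨?_, hm⟩, ?_⟩ rfl rfl
      · rw [← affineExponent_basisIndex m hm, ← h, affineExponent_basisIndex]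
      · rintro ⟨rfl, -⟩
        rfl
    · rw [affineMonomial_eq_zero hm', inner_zero_right, if_neg]
      rintro ⟨rfl, h⟩
      exact hm' h
  · rw [affineMonomial_eq_zero hm, inner_zero_left, if_neg fun h => hm h.2]

theorem inner_affineMonomial_of_ne {m m' : (Σ i, Fin (n i)) →₀ ℕ} (h : m ≠ m') :
    ⟪affineMonomial n d m, affineMonomial n d m'⟫_ℝ = 0 := by
  classical
  rw [inner_affineMonomial, if_neg fun h' => h h'.1]

theorem inner_affineMonomial_self {m : (Σ i, Fin (n i)) →₀ ℕ} (h : IsAdmissible d m) :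
    ⟪affineMonomial n d m, affineMonomial n d m⟫_ℝ = 1 := by
  classical
  rw [inner_affineMonomial, if_pos ⟨rfl, h⟩]

theorem ext_inner_affineMonomial {F G : PSTensor n d}
    (h : ∀ m, IsAdmissible d m → ⟪affineMonomial n d m, F⟫_ℝ = ⟪affineMonomial n d m, G⟫_ℝ) :
    F = G := by
  apply (tensorBasis n d).ext_elem
  intro α
  rw [← inner_tensorBasis, ← inner_tensorBasis, ← affineMonomial_affineExponent]
  exact h _ (isAdmissible_affineExponent α)

/-! ### The affine parametrization -/

variable (n d) in
/-- The linear forms `x_0 + ∑ (t_{ik} / √d_i) x_k`. -/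
def affineForm (t : (Σ i, Fin (n i)) → ℝ) (i : Fin r) : Fin (n i + 1) → ℝ :=
  Fin.cons 1 fun k => t ⟨i, k⟩ / √(d i : ℝ)

variable (n d) in
/-- The affine parametrization of the cone over the Segre–Veronese manifold near the base point. -/
def affineParam (t : (Σ i, Fin (n i)) → ℝ) : PSTensor n d := powerTensor d (affineForm n d t)

variable (d) in
/-- The coefficient of the monomial `t^m` in the affine parametrization. -/
def paramCoeff (m : (Σ i, Fin (n i)) →₀ ℕ) : ℝ :=
  ∏ i, √((homExponent n d m i).multinomial : ℝ) / √(d i : ℝ) ^ ∑ k, m ⟨i, k⟩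

/-- Slotwise multinomial theorem: x_0 has coefficient 1, so only the affine variables remain, and
the denominators √d_i collect into a power of √d_i. -/
theorem inner_affineMonomial_affineParam {m : (Σ i, Fin (n i)) →₀ ℕ} (hm : IsAdmissible d m)
    (t : (Σ i, Fin (n i)) → ℝ) :
    ⟪affineMonomial n d m, affineParam n d t⟫_ℝ = paramCoeff d m * ∏ p, t p ^ m p := by
  rw [affineMonomial_eq_tensorBasis hm, inner_tensorBasis, affineParam,
    tensorBasis_repr_powerTensor, Fintype.prod_sigma, paramCoeff, ← Finset.prod_mul_distrib]
  refine Finset.prod_congr rfl fun i _ => ?_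
  simp only [basisIndex, affineForm]
  rw [Fin.prod_univ_succ]
  simp only [Fin.cons_zero, Fin.cons_succ, one_pow, one_mul, homExponent_succ, div_pow,
    Finset.prod_div_distrib, Finset.prod_pow_eq_pow_sum]
  ring

theorem affineParam_eq_sum (t : (Σ i, Fin (n i)) → ℝ) :
    affineParam n d t = ∑ α, (paramCoeff d (affineExponent α) *
      ∏ p, t p ^ affineExponent α p) • tensorBasis n d α := by
  rw [← (tensorBasis n d).sum_repr (affineParam n d t)]
  refine Finset.sum_congr rfl fun α _ => ?_
  rw [← inner_tensorBasis, ← affineMonomial_affineExponent,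
    inner_affineMonomial_affineParam (isAdmissible_affineExponent α)]

theorem contDiff_affineParam : ContDiff ℝ ∞ (affineParam n d) := by
  have h : affineParam n d = fun t => ∑ α, (paramCoeff d (affineExponent α) *
      ∏ p, t p ^ affineExponent α p) • tensorBasis n d α := funext affineParam_eq_sum
  rw [h]
  exact ContDiff.sum fun α _ => (contDiff_const.mul (contDiff_prod fun p _ =>
    (contDiff_apply ℝ ℝ p).pow _)).smul contDiff_const

theorem homExponent_of_forall_eq_zero {m : (Σ i, Fin (n i)) →₀ ℕ} {i : Fin r}
    (h : ∀ k, m ⟨i, k⟩ = 0) : homExponent n d m i = Finsupp.single 0 (d i) := by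
  ext k
  refine Fin.cases ?_ (fun k => ?_) k <;> simp [h]

theorem x0Pow_eq_scaledMonomial (n d : ℕ) :
    x0Pow n d = scaledMonomial (Finsupp.single 0 d) := by
  refine Subtype.ext ?_
  rw [scaledMonomial, dif_pos (Finsupp.degree_single _ _), x0Pow]
  simp [X_pow_eq_monomial,
    Finsupp.multinomial_eq_of_support_subset Finsupp.support_single_subset]

theorem basePoint_eq : basePoint n d = affineMonomial n d 0 :=
  congrArg simpleTensor (funext fun i => by
    rw [homExponent_of_forall_eq_zero fun _ => rfl, x0Pow_eq_scaledMonomial])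

theorem isAdmissible_zero : IsAdmissible d (0 : (Σ i, Fin (n i)) →₀ ℕ) := fun i => by simp

theorem sum_single_apply (p : Σ i, Fin (n i)) (i : Fin r) (c : ℕ) :
    ∑ k, Finsupp.single p c ⟨i, k⟩ = if p.1 = i then c else 0 := by
  classical
  obtain ⟨j, l⟩ := p
  split_ifs with h
  · cases h
    rw [Finset.sum_eq_single l]
    · simp
    · intro k _ hk
      rw [Finsupp.single_apply, if_neg]
      rintro ⟨⟩
      exact hk rfl
    · simp
  · refine Finset.sum_eq_zero fun k _ => ?_
    rw [Finsupp.single_apply, if_neg]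
    rintro ⟨⟩
    exact h rfl

theorem isAdmissible_single (hd : ∀ i, 1 ≤ d i) (p : Σ i, Fin (n i)) :
    IsAdmissible d (Finsupp.single p 1) := fun i => by
  rw [sum_single_apply]
  split_ifs
  · exact hd i
  · exact Nat.zero_le _


/-! ### Values of the coefficients of order at most two. -/

theorem multinomial_homExponent {m : (Σ i, Fin (n i)) →₀ ℕ} (hm : IsAdmissible d m) (i : Fin r) :
    (d i - ∑ k, m ⟨i, k⟩).factorial * (∏ k, (m ⟨i, k⟩).factorial) *
      (homExponent n d m i).multinomial = (d i).factorial := by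
  have h := Nat.multinomial_spec Finset.univ (homExponent n d m i)
  rw [← Finsupp.degree_eq_sum, (degree_homExponent m i).2 (hm i), Fin.prod_univ_succ] at h
  rw [Finsupp.multinomial_eq_of_support_subset (Finset.subset_univ _)]
  exact h

theorem paramCoeff_factor_of_eq_zero {m : (Σ i, Fin (n i)) →₀ ℕ} {i : Fin r}
    (hm : IsAdmissible d m) (h : ∀ k, m ⟨i, k⟩ = 0) :
    √((homExponent n d m i).multinomial : ℝ) / √(d i : ℝ) ^ ∑ k, m ⟨i, k⟩ = 1 := by
  have h1 := multinomial_homExponent hm i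
  simp only [h, Finset.sum_const_zero, tsub_zero, Nat.factorial_zero, Finset.prod_const_one,
    mul_one] at h1
  have h2 : (homExponent n d m i).multinomial = 1 :=
    Nat.eq_of_mul_eq_mul_left (Nat.factorial_pos (d i)) (by rw [h1, mul_one])
  simp [h, h2]

theorem sqrt_div_sqrt_pow_one {c : ℕ} (hc : 1 ≤ c) : √(c : ℝ) / √(c : ℝ) ^ 1 = 1 := by
  rw [pow_one]
  exact div_self (Real.sqrt_pos.2 (Nat.cast_pos.2 hc)).ne'

/-- Here the multinomial is d_i; the scaling t/√d_i in `affineForm` was chosen to cancel its square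
root. -/
theorem paramCoeff_factor_of_sum_eq_one {m : (Σ i, Fin (n i)) →₀ ℕ} {i : Fin r}
    (hm : IsAdmissible d m) (h : ∑ k, m ⟨i, k⟩ = 1) :
    √((homExponent n d m i).multinomial : ℝ) / √(d i : ℝ) ^ ∑ k, m ⟨i, k⟩ = 1 := by
  have hd : 1 ≤ d i := h ▸ hm i
  have h1 := multinomial_homExponent hm i
  have h2 : ∏ k, (m ⟨i, k⟩).factorial = 1 := Finset.prod_eq_one fun k _ => by
    have : m ⟨i, k⟩ ≤ 1 := h ▸ Finset.single_le_sum (f := fun k => m ⟨i, k⟩)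
      (fun _ _ => Nat.zero_le _) (Finset.mem_univ k)
    exact Nat.factorial_eq_one.2 this
  rw [h2, h, mul_one, ← Nat.mul_factorial_pred (Nat.one_le_iff_ne_zero.1 hd), mul_comm (d i)] at h1
  rw [Nat.eq_of_mul_eq_mul_left (Nat.factorial_pos _) h1, h, sqrt_div_sqrt_pow_one hd]

theorem paramCoeff_single (hd : ∀ i, 1 ≤ d i) (p : Σ i, Fin (n i)) :
    paramCoeff d (Finsupp.single p 1) = 1 := by
  refine Finset.prod_eq_one fun i _ => ?_
  have ha := isAdmissible_single hd p
  by_cases h : p.1 = i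
  · exact paramCoeff_factor_of_sum_eq_one ha (by rw [sum_single_apply, if_pos h])
  · refine paramCoeff_factor_of_eq_zero ha fun k => ?_
    rw [Finsupp.single_apply, if_neg]
    rintro rfl
    exact h rfl

/-- The exponent vector of the product of two affine variables. -/
abbrev pairExponent (p q : Σ i, Fin (n i)) : (Σ i, Fin (n i)) →₀ ℕ :=
  Finsupp.single p 1 + Finsupp.single q 1

theorem sum_pair_apply (p q : Σ i, Fin (n i)) (i : Fin r) :
    ∑ k, pairExponent p q ⟨i, k⟩ =
      (if p.1 = i then 1 else 0) + if q.1 = i then 1 else 0 := by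
  simp only [Finsupp.add_apply, Finset.sum_add_distrib, sum_single_apply]

theorem isAdmissible_pair_of_ne (hd : ∀ i, 1 ≤ d i) {p q : Σ i, Fin (n i)} (h : p.1 ≠ q.1) :
    IsAdmissible d (pairExponent p q) := fun i => by
  rw [sum_pair_apply]
  have := hd i
  split_ifs <;> lia

theorem isAdmissible_pair_of_eq {i : Fin r} (k l : Fin (n i)) :
    IsAdmissible d (pairExponent ⟨i, k⟩ ⟨i, l⟩) ↔ 2 ≤ d i := by
  constructor
  · intro h
    have := h i
    rw [sum_pair_apply] at this
    simpa using this
  · intro h j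
    rw [sum_pair_apply]
    by_cases hj : i = j
    · subst hj
      simpa using h
    · simp [hj]

theorem paramCoeff_pair_of_ne (hd : ∀ i, 1 ≤ d i) {p q : Σ i, Fin (n i)} (h : p.1 ≠ q.1) :
    paramCoeff d (pairExponent p q) = 1 := by
  refine Finset.prod_eq_one fun i _ => ?_
  have ha := isAdmissible_pair_of_ne hd h
  have hs := sum_pair_apply p q i
  by_cases h1 : p.1 = i
  · have h2 : q.1 ≠ i := fun h2 => h (h1.trans h2.symm)
    rw [if_pos h1, if_neg h2] at hs
    exact paramCoeff_factor_of_sum_eq_one ha hs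
  · by_cases h2 : q.1 = i
    · rw [if_neg h1, if_pos h2] at hs
      exact paramCoeff_factor_of_sum_eq_one ha hs
    · rw [if_neg h1, if_neg h2, add_zero, Finset.sum_eq_zero_iff] at hs
      exact paramCoeff_factor_of_eq_zero ha fun k => hs k (Finset.mem_univ k)

/-- Only slot i contributes. Its multinomial is d(d-1)/c with c = 2 for a square and c = 1
otherwise, and √(d(d-1)/c)/d = √((d-1)/d)/√c. -/
theorem paramCoeff_pair_of_eq {i : Fin r} (hi : 2 ≤ d i) (k l : Fin (n i)) :
    paramCoeff d (pairExponent ⟨i, k⟩ ⟨i, l⟩) =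
      √(((d i : ℝ) - 1) / d i) / if k = l then √2 else 1 := by
  have ha := (isAdmissible_pair_of_eq k l).2 hi
  have h0 : ∀ j k', j ≠ i → pairExponent ⟨i, k⟩ ⟨i, l⟩ ⟨j, k'⟩ = 0 := by
    intro j k' hj
    have hne : ∀ k : Fin (n i), ¬(⟨i, k⟩ : Σ i, Fin (n i)) = ⟨j, k'⟩ := fun k h =>
      hj (congrArg Sigma.fst h).symm
    rw [Finsupp.add_apply, Finsupp.single_apply, Finsupp.single_apply, if_neg (hne k),
      if_neg (hne l), add_zero]
  rw [paramCoeff, Finset.prod_eq_single i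
    (fun j _ hj => paramCoeff_factor_of_eq_zero ha fun k' => h0 j k' hj) (by simp)]
  have h1 := multinomial_homExponent ha i
  have hs : ∑ k', pairExponent ⟨i, k⟩ ⟨i, l⟩ ⟨i, k'⟩
      = 2 := by
    rw [sum_pair_apply]
    simp
  have hf : ∏ k', (pairExponent ⟨i, k⟩ ⟨i, l⟩ ⟨i, k'⟩).factorial = if k = l then 2 else 1 := by
    split_ifs with hkl
    · subst hkl
      rw [Finset.prod_eq_single k]
      · simp
      · intro k' _ hk'
        simp [hk'.symm]
      · simp
    · refine Finset.prod_eq_one fun k' _ => ?_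
      by_cases hk : k = k'
      · subst hk
        simp [Ne.symm hkl]
      · by_cases hl : l = k' <;> simp [hk, hl]
  rw [hs, hf] at h1
  rw [hs, Real.sq_sqrt (Nat.cast_nonneg _)]
  -- Writing d_i = e + 2 removes the truncated subtraction, so that e! can be cancelled in ℕ.
  obtain ⟨e, he⟩ := Nat.exists_eq_add_of_le' hi
  have hmul : (if k = l then 2 else 1 : ℝ) * ((homExponent n d (pairExponent ⟨i, k⟩ ⟨i, l⟩) i).multinomial : ℝ) =
        (d i : ℝ) * ((d i : ℝ) - 1) := by
    rw [he, Nat.add_sub_cancel, Nat.factorial_succ, Nat.factorial_succ] at h1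
    have h2 : (if k = l then 2 else 1) * (homExponent n d (pairExponent ⟨i, k⟩ ⟨i, l⟩) i).multinomial = (e + 2) * (e + 1) := by
      apply Nat.eq_of_mul_eq_mul_left (Nat.factorial_pos e)
      rw [← mul_assoc, h1]
      ring
    have h3 := congrArg (Nat.cast (R := ℝ)) h2
    push_cast at h3
    rw [h3, he]
    push_cast
    ring
  have hd0 : (0 : ℝ) < d i := by
    rw [Nat.cast_pos]
    lia
  have hd1 : (0 : ℝ) ≤ (d i : ℝ) - 1 := by
    rw [sub_nonneg, Nat.one_le_cast]
    lia
  set M : ℝ := ((homExponent n d (pairExponent ⟨i, k⟩ ⟨i, l⟩) i).multinomial : ℝ)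
  have hq : √M * √(if k = l then 2 else 1) = √(d i : ℝ) * √((d i : ℝ) - 1) := by
    rw [← Real.sqrt_mul' _ (by split_ifs <;> norm_num), ← Real.sqrt_mul hd0.le, mul_comm M, hmul]
  have hite : (if k = l then √2 else 1 : ℝ) = √(if k = l then 2 else 1) := by
    split_ifs <;> simp
  have hpos : (0 : ℝ) < √(if k = l then 2 else 1) :=
    Real.sqrt_pos.2 (by split_ifs <;> norm_num)
  have hsd := Real.sqrt_pos.2 hd0
  rw [hite, Real.sqrt_div hd1, div_div, div_eq_div_iff hd0.ne' (by positivity)]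
  calc √M * (√(d i : ℝ) * √(if k = l then 2 else 1))
      = (√M * √(if k = l then 2 else 1)) * √(d i : ℝ) := by ring
    _ = √((d i : ℝ) - 1) * (√(d i : ℝ) * √(d i : ℝ)) := by rw [hq]; ring
    _ = _ := by rw [Real.mul_self_sqrt hd0.le]

/-! ### The Segre–Veronese manifold as a radial graph -/

/-! ### Second derivatives of functionals and of products. -/

section Hessian

variable {P V : Type*} [NormedAddCommGroup P] [NormedSpace ℝ P] [NormedAddCommGroup V]
  [NormedSpace ℝ V]

theorem map_fderiv_fderiv {Φ : P → V} (hΦ : ContDiff ℝ ∞ Φ) (l : V →L[ℝ] ℝ) (x w v : P) :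
    l (fderiv ℝ (fderiv ℝ Φ) x w v) = fderiv ℝ (fderiv ℝ fun t => l (Φ t)) x w v := by
  have h1 : (fderiv ℝ fun t => l (Φ t)) = fun t => l.comp (fderiv ℝ Φ t) := by
    funext t
    exact (l.hasFDerivAt.comp t
      ((hΦ.differentiable (by simp)).differentiableAt).hasFDerivAt).fderiv
  have h2 : ContDiff ℝ ∞ (fderiv ℝ Φ) := hΦ.fderiv_right (by simp)
  have h3 := ((ContinuousLinearMap.compL ℝ P V ℝ l).hasFDerivAt.comp x
    ((h2.differentiable (by simp)).differentiableAt).hasFDerivAt).fderiv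
  rw [h1]
  change _ = fderiv ℝ (⇑(ContinuousLinearMap.compL ℝ P V ℝ l) ∘ fderiv ℝ Φ) x w v
  rw [h3]
  rfl

/-- By Leibniz, only the terms in which both linear factors are differentiated survive at the
origin. -/
theorem fderiv_fderiv_mul_mul (l l' : P →L[ℝ] ℝ) {g : P → ℝ} (hg : ContDiff ℝ ∞ g) (w v : P) :
    fderiv ℝ (fderiv ℝ fun t => l t * (l' t * g t)) 0 w v =
      (l w * l' v + l' w * l v) * g 0 := by
  have hg' : ∀ t, HasFDerivAt g (fderiv ℝ g t) t := fun t =>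
    ((hg.differentiable (by simp)).differentiableAt).hasFDerivAt
  have h1 : (fderiv ℝ fun t => l t * (l' t * g t)) = fun t =>
      l t • (l' t • fderiv ℝ g t + g t • l') + (l' t * g t) • l := by
    funext t
    exact (l.hasFDerivAt.mul (l'.hasFDerivAt.mul (hg' t))).fderiv
  have h2 : HasFDerivAt (fderiv ℝ g) (fderiv ℝ (fderiv ℝ g) 0) 0 :=
    (((hg.fderiv_right (m := ∞) (by simp)).differentiable (by simp)).differentiableAt).hasFDerivAt
  have h3 := (l.hasFDerivAt (x := 0)).smul (((l'.hasFDerivAt (x := 0)).smul h2).add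
    ((hg' 0).smul (hasFDerivAt_const l' 0)))
  have h4 := ((l'.hasFDerivAt (x := 0)).mul (hg' 0)).smul (hasFDerivAt_const l 0)
  rw [h1]
  have h5 := (h3.add h4).fderiv
  refine (congrArg (fun L => L w v) h5).trans ?_
  simp
  ring

end Hessian

/-! ### Monomial functions at the origin. -/

section PolynomialHessian

variable {ι : Type*}

theorem contDiff_monomial [Fintype ι] (m : ι →₀ ℕ) : ContDiff ℝ ∞ fun t : ι → ℝ => ∏ x, t x ^ m x :=
  contDiff_prod fun x _ => (contDiff_apply ℝ ℝ x).pow _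

theorem prod_pow_single_add [Fintype ι] (x : ι) (m : ι →₀ ℕ) (t : ι → ℝ) :
    ∏ y, t y ^ (Finsupp.single x 1 + m : ι →₀ ℕ) y = t x * ∏ y, t y ^ m y := by
  classical
  simp only [Finsupp.add_apply, pow_add, Finset.prod_mul_distrib]
  congr 1
  rw [Finset.prod_eq_single x]
  · simp
  · intro y _ hy
    simp [hy.symm]
  · simp

theorem prod_zero_pow [Fintype ι] (m : ι →₀ ℕ) : ∏ x, (0 : ℝ) ^ m x = if m = 0 then 1 else 0 := by
  split_ifs with h
  · simp [h]
  · obtain ⟨x, hx⟩ := Finsupp.ne_iff.1 h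
    exact Finset.prod_eq_zero (Finset.mem_univ x) (zero_pow hx)

/-- Two sums of two unit vectors agree only if the summands agree up to order. -/
theorem single_add_single_eq_iff {p q p' q' : ι} :
    (Finsupp.single p 1 + Finsupp.single q 1 : ι →₀ ℕ) =
      Finsupp.single p' 1 + Finsupp.single q' 1 ↔ p = p' ∧ q = q' ∨ p = q' ∧ q = p' := by
  constructor
  · classical
    intro h
    have h1 := DFunLike.congr_fun h p
    have h2 := DFunLike.congr_fun h q
    have h3 := DFunLike.congr_fun h p'
    simp only [Finsupp.add_apply, Finsupp.single_apply] at h1 h2 h3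
    grind
  · rintro (⟨rfl, rfl⟩ | ⟨rfl, rfl⟩)
    · rfl
    · exact add_comm _ _

/-- The differential at the origin of a monomial function. -/
theorem fderiv_monomial [Fintype ι] [DecidableEq ι] (m : ι →₀ ℕ) (p : ι) :
    fderiv ℝ (fun t : ι → ℝ => ∏ x, t x ^ m x) 0 (Pi.single p 1) =
      if m = Finsupp.single p 1 then 1 else 0 := by
  rcases hm : m.degree with _ | c
  · rw [(Finsupp.degree_eq_zero_iff m).1 hm, if_neg]
    · simp
    · intro h
      have := DFunLike.congr_fun h p
      simp at this
  obtain ⟨x, m, rfl, -⟩ := exists_eq_single_add hm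
  have h1 := ((ContinuousLinearMap.proj x : (ι → ℝ) →L[ℝ] ℝ).hasFDerivAt (x := 0)).mul
    (((contDiff_monomial m).differentiable (by simp)).differentiableAt (x := 0)).hasFDerivAt
  have h2 : (fun t : ι → ℝ => ∏ y, t y ^ (Finsupp.single x 1 + m : ι →₀ ℕ) y) =
      ⇑(ContinuousLinearMap.proj x : (ι → ℝ) →L[ℝ] ℝ) * fun t => ∏ y, t y ^ m y :=
    funext fun t => prod_pow_single_add x m t
  rw [h2, h1.fderiv]
  simp only [smul_apply, map_zero, zero_smul,
    zero_add, ContinuousLinearMap.proj_apply, smul_eq_mul, Pi.zero_apply, prod_zero_pow,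
    Pi.single_apply]
  by_cases h0 : m = 0
  · subst h0
    simp [Finsupp.single_left_inj]
  · rw [if_neg h0, zero_mul, if_neg]
    intro h
    apply h0
    have := congrArg Finsupp.degree h
    simp only [map_add, Finsupp.degree_single] at this
    exact (Finsupp.degree_eq_zero_iff m).1 (by lia)

/-- The Hessian at the origin of a monomial function. -/
theorem fderiv_fderiv_monomial [Fintype ι] [DecidableEq ι] (m : ι →₀ ℕ) (p q : ι) :
    fderiv ℝ (fderiv ℝ fun t : ι → ℝ => ∏ x, t x ^ m x) 0 (Pi.single p 1) (Pi.single q 1) =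
      if m = Finsupp.single p 1 + Finsupp.single q 1 then (if p = q then 2 else 1) else 0 := by
  rcases hm : m.degree with _ | c
  · rw [(Finsupp.degree_eq_zero_iff m).1 hm, if_neg]
    · simp
    · intro h
      have := congrArg Finsupp.degree h
      simp at this
  obtain ⟨x, m, rfl, hc⟩ := exists_eq_single_add hm
  rcases c with _ | c
  · rw [(Finsupp.degree_eq_zero_iff m).1 hc, if_neg]
    · have h1 : (fun t : ι → ℝ => ∏ y, t y ^ (Finsupp.single x 1 + 0 : ι →₀ ℕ) y) =
          (ContinuousLinearMap.proj x : (ι → ℝ) →L[ℝ] ℝ) := by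
        funext t
        rw [prod_pow_single_add]
        simp
      have h2 : fderiv ℝ (ContinuousLinearMap.proj x : (ι → ℝ) →L[ℝ] ℝ) =
          fun _ => ContinuousLinearMap.proj x := by
        funext t
        exact ContinuousLinearMap.fderiv _
      rw [h1, h2]
      simp
    · intro h
      have := congrArg Finsupp.degree h
      simp at this
  -- In degree at least two, two variables are split off. The remaining monomial is evaluated at 0,
  -- so it must be trivial for the Hessian to be nonzero.
  obtain ⟨y, m, rfl, -⟩ := exists_eq_single_add hc
  have h1 : (fun t : ι → ℝ => ∏ z, t z ^ (Finsupp.single x 1 + (Finsupp.single y 1 + m) : ι →₀ ℕ) z) =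
      fun t => (ContinuousLinearMap.proj x : (ι → ℝ) →L[ℝ] ℝ) t *
        ((ContinuousLinearMap.proj y : (ι → ℝ) →L[ℝ] ℝ) t * ∏ z, t z ^ m z) := by
    funext t
    rw [prod_pow_single_add, prod_pow_single_add]
    rfl
  rw [h1, fderiv_fderiv_mul_mul _ _ (contDiff_monomial m)]
  simp only [Pi.zero_apply, prod_zero_pow, ContinuousLinearMap.proj_apply, Pi.single_apply]
  by_cases h0 : m = 0
  · subst h0
    rw [add_zero, if_pos rfl]
    simp only [single_add_single_eq_iff]
    grind
  · rw [if_neg h0, mul_zero, if_neg]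
    intro h
    apply h0
    have := congrArg Finsupp.degree h
    simp only [map_add, Finsupp.degree_single] at this
    exact (Finsupp.degree_eq_zero_iff m).1 (by lia)

end PolynomialHessian


/-! ### The graph conditions and the derivatives of the affine parametrization. -/

variable (n d) in
/-- The coordinates in the tangent directions at the base point. -/
def tangentCoord : PSTensor n d →L[ℝ] ((Σ i, Fin (n i)) → ℝ) :=
  ContinuousLinearMap.pi fun p => innerSL ℝ (affineMonomial n d (Finsupp.single p 1))

@[simp]
theorem tangentCoord_apply (F : PSTensor n d) (p : Σ i, Fin (n i)) :
    tangentCoord n d F p = ⟪affineMonomial n d (Finsupp.single p 1), F⟫_ℝ := rfl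

theorem paramCoeff_zero : paramCoeff d (0 : (Σ i, Fin (n i)) →₀ ℕ) = 1 :=
  Finset.prod_eq_one fun _ _ => paramCoeff_factor_of_eq_zero isAdmissible_zero fun _ => rfl

theorem inner_basePoint_affineParam (t : (Σ i, Fin (n i)) → ℝ) :
    ⟪basePoint n d, affineParam n d t⟫_ℝ = 1 := by
  rw [basePoint_eq, inner_affineMonomial_affineParam isAdmissible_zero, paramCoeff_zero]
  simp

theorem tangentCoord_affineParam (hd : ∀ i, 1 ≤ d i) (t : (Σ i, Fin (n i)) → ℝ) :
    tangentCoord n d (affineParam n d t) = t := by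
  classical
  funext p
  rw [tangentCoord_apply, inner_affineMonomial_affineParam (isAdmissible_single hd p),
    paramCoeff_single hd, one_mul, ← add_zero (Finsupp.single p 1), prod_pow_single_add]
  simp

theorem affineParam_zero : affineParam n d 0 = basePoint n d := by
  classical
  refine ext_inner_affineMonomial fun m hm => ?_
  rw [inner_affineMonomial_affineParam hm, basePoint_eq, inner_affineMonomial]
  simp only [Pi.zero_apply, prod_zero_pow, hm, and_true]
  split_ifs with h
  · rw [h, paramCoeff_zero, one_mul]
  · rw [mul_zero]

theorem norm_basePoint : ‖basePoint n d‖ = 1 := by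
  have h := inner_affineMonomial_self (isAdmissible_zero (n := n) (d := d))
  rw [← basePoint_eq, real_inner_self_eq_norm_sq] at h
  exact (pow_eq_one_iff_of_nonneg (norm_nonneg _) two_ne_zero).1 h

theorem basePoint_mem_segreVeronese : basePoint n d ∈ segreVeronese n d := by
  refine ⟨⟨fun i => x0Pow (n i) (d i), fun i => ?_, rfl⟩, by simp [norm_basePoint]⟩
  exact ⟨X 0, (mem_homogeneousSubmodule 1 _).2 (isHomogeneous_X _ _), Or.inl rfl⟩

theorem inner_basePoint_powerTensor_eq_zero (hd : ∀ i, 1 ≤ d i) {a : ∀ i, Fin (n i + 1) → ℝ}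
    {i : Fin r} (h : a i 0 = 0) : ⟪basePoint n d, powerTensor d a⟫_ℝ = 0 := by
  rw [basePoint_eq, affineMonomial_eq_tensorBasis isAdmissible_zero, inner_tensorBasis,
    tensorBasis_repr_powerTensor]
  refine Finset.prod_eq_zero (Finset.mem_univ i) (mul_eq_zero_of_right _
    (Finset.prod_eq_zero (Finset.mem_univ 0) ?_))
  rw [h]
  refine zero_pow ?_
  have := hd i
  simp only [basisIndex, homExponent_zero, Finsupp.coe_zero, Pi.zero_apply, Finset.sum_const_zero]
  lia

theorem isRadialGraph_segreVeronese (hd : ∀ i, 1 ≤ d i) :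
    IsRadialGraph (segreVeronese n d) (basePoint n d) (tangentCoord n d) (affineParam n d) where
  contDiff := contDiff_affineParam
  map_zero := affineParam_zero
  inner_eq_one := inner_basePoint_affineParam
  left_inv := tangentCoord_affineParam hd
  normalize_mem t := by
    have h0 : affineParam n d t ≠ 0 := fun h => by
      have := inner_basePoint_affineParam (d := d) t
      simp [h] at this
    -- For r = 0 no slot can absorb the norm, but then the parameter space is a point.
    rcases isEmpty_or_nonempty (Fin r) with hr | ⟨⟨i⟩⟩
    · rw [Subsingleton.elim t 0, affineParam_zero, norm_basePoint, inv_one, one_smul]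
      exact basePoint_mem_segreVeronese
    · exact smul_powerTensor_mem_segreVeronese hd i (inv_nonneg.2 (norm_nonneg _)) _
        (norm_smul_inv_norm (𝕜 := ℝ) h0)
  eq_of_mem u hu hpos := by
    obtain ⟨σ, a, rfl⟩ := exists_eq_powerTensor_of_mem_segreVeronese hu
    -- A linear form without x_0-term would make the tensor orthogonal to E.
    have ha : ∀ i, a i 0 ≠ 0 := fun i h => by
      rw [inner_smul_right, inner_basePoint_powerTensor_eq_zero hd h, mul_zero] at hpos
      exact lt_irrefl _ hpos
    have hform : a = fun i => a i 0 •
        affineForm n d (fun p => √(d p.1 : ℝ) * a p.1 p.2.succ / a p.1 0) i := by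
      funext i k
      have hdi : √(d i : ℝ) ≠ 0 := (Real.sqrt_pos.2 (Nat.cast_pos.2 (hd i))).ne'
      have hai := ha i
      refine Fin.cases ?_ (fun k => ?_) k
      · simp [affineForm]
      · simp only [affineForm, Pi.smul_apply, Fin.cons_succ, smul_eq_mul]
        field_simp
    have hu' : σ • powerTensor d a = (σ * ∏ i, a i 0 ^ d i) •
        affineParam n d (fun p => √(d p.1 : ℝ) * a p.1 p.2.succ / a p.1 0) := by
      conv_lhs => rw [hform]
      rw [powerTensor_smul, smul_smul, affineParam]
    -- The graph has inner product 1 with E, so the scalar in front of it is exactly the inner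
    -- product of u with E.
    rw [hu', inner_smul_right, inner_basePoint_affineParam, mul_one] at hpos ⊢
    rw [map_smul, tangentCoord_affineParam hd, smul_smul, inv_mul_cancel₀ hpos.ne', one_smul]
  norm_eq_one u hu := by simpa using hu.2

/-- The Hessian of the affine parametrization at the origin. -/
theorem fderiv_fderiv_affineParam (p q : Σ i, Fin (n i)) :
    fderiv ℝ (fderiv ℝ (affineParam n d)) 0 (Pi.single p 1) (Pi.single q 1) =
      (paramCoeff d (pairExponent p q) * if p = q then 2 else 1) •
        affineMonomial n d (pairExponent p q) := by
  refine ext_inner_affineMonomial fun m hm => ?_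
  have h1 := map_fderiv_fderiv (contDiff_affineParam (n := n) (d := d))
    (innerSL ℝ (affineMonomial n d m)) 0 (Pi.single p 1) (Pi.single q 1)
  simp only [innerSL_apply_apply, inner_affineMonomial_affineParam hm] at h1
  -- The functional is multiplication by the constant coefficient, which is thereby pulled out of
  -- the Hessian.
  have h2 := map_fderiv_fderiv (contDiff_monomial m)
    (paramCoeff d m • ContinuousLinearMap.id ℝ ℝ) 0 (Pi.single p 1) (Pi.single q 1)
  simp only [smul_apply, ContinuousLinearMap.id_apply, smul_eq_mul] at h2
  rw [h1, ← h2, fderiv_fderiv_monomial, inner_smul_right]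
  by_cases h : m = pairExponent p q
  · subst h
    rw [if_pos rfl, inner_affineMonomial_self hm, mul_one]
  · rw [if_neg h, inner_affineMonomial_of_ne h, mul_zero, mul_zero]

theorem fderiv_affineParam (hd : ∀ i, 1 ≤ d i) (p : Σ i, Fin (n i)) :
    fderiv ℝ (affineParam n d) 0 (Pi.single p 1) = affineMonomial n d (Finsupp.single p 1) := by
  refine ext_inner_affineMonomial fun m hm => ?_
  have h1 := ((innerSL ℝ (affineMonomial n d m)).hasFDerivAt.comp 0
    (((contDiff_affineParam (n := n) (d := d)).differentiable
      (by simp)).differentiableAt).hasFDerivAt).fderiv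
  have h2 : (⇑(innerSL ℝ (affineMonomial n d m)) ∘ affineParam n d) =
      fun t => paramCoeff d m * ∏ p, t p ^ m p :=
    funext fun t => inner_affineMonomial_affineParam hm t
  rw [h2, fderiv_const_mul (((contDiff_monomial m).differentiable (by simp)).differentiableAt)]
    at h1
  have h3 := DFunLike.congr_fun h1 (Pi.single p 1)
  rw [smul_apply, fderiv_monomial] at h3
  refine h3.symm.trans ?_
  by_cases h : m = Finsupp.single p 1
  · subst h
    rw [if_pos rfl, inner_affineMonomial_self hm, paramCoeff_single hd, smul_eq_mul, mul_one]
  · rw [if_neg h, inner_affineMonomial_of_ne h, smul_zero]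

/-! ### The distinguished tensors in terms of affine exponents -/

theorem tangentVec_eq (i : Fin r) (k : Fin (n i)) :
    tangentVec n d i k = affineMonomial n d (Finsupp.single ⟨i, k⟩ 1) := by
  refine congrArg simpleTensor (funext fun j => ?_)
  by_cases hj : j = i
  · subst hj
    rw [Function.update_self, linMonomial]
    congr 1
    ext x
    refine Fin.cases ?_ (fun x => ?_) x
    · simp [sum_single_apply]
    · simp [Finsupp.single_apply]
  · rw [Function.update_of_ne hj, homExponent_of_forall_eq_zero, x0Pow_eq_scaledMonomial]
    intro x
    rw [Finsupp.single_apply, if_neg]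
    rintro ⟨⟩
    exact hj rfl

theorem sigma_mk_eq_iff {i : Fin r} {k l : Fin (n i)} :
    (⟨i, k⟩ : Σ i, Fin (n i)) = ⟨i, l⟩ ↔ k = l :=
  ⟨fun h => eq_of_heq (Sigma.mk.inj h).2, fun h => by rw [h]⟩

theorem sigma_mk_ne {i j : Fin r} (h : i ≠ j) (k : Fin (n i)) (l : Fin (n j)) :
    (⟨i, k⟩ : Σ i, Fin (n i)) ≠ ⟨j, l⟩ := fun h' => h (congrArg Sigma.fst h')

/-- The same truncated d_i - 2 occurs on both sides, so the exponents agree even for d_i = 1, where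
both tensors vanish. -/
theorem simpleTensor_update_quad (i : Fin r) (k l : Fin (n i)) :
    simpleTensor (Function.update (fun j => x0Pow (n j) (d j)) i (scaledMonomial
      (Finsupp.single 0 (d i - 2) + Finsupp.single k.succ 1 + Finsupp.single l.succ 1))) =
      affineMonomial n d (pairExponent ⟨i, k⟩ ⟨i, l⟩) := by
  refine congrArg simpleTensor (funext fun j => ?_)
  by_cases hj : j = i
  · subst hj
    rw [Function.update_self]
    congr 1
    ext x
    refine Fin.cases ?_ (fun x => ?_) x
    · rw [homExponent_zero, sum_pair_apply]
      simp
    · rw [homExponent_succ]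
      simp [Finsupp.single_apply]
  · rw [Function.update_of_ne hj, homExponent_of_forall_eq_zero, x0Pow_eq_scaledMonomial]
    intro x
    rw [Finsupp.add_apply, Finsupp.single_eq_of_ne (sigma_mk_ne hj _ _),
      Finsupp.single_eq_of_ne (sigma_mk_ne hj _ _), add_zero]

theorem simpleTensor_update_update {i j : Fin r} (hij : i ≠ j) (k : Fin (n i)) (l : Fin (n j)) :
    simpleTensor (Function.update (Function.update (fun s => x0Pow (n s) (d s)) i (linMonomial k))
      j (linMonomial l)) = affineMonomial n d (pairExponent ⟨i, k⟩ ⟨j, l⟩) := by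
  refine congrArg simpleTensor (funext fun s => ?_)
  by_cases hj : s = j
  · subst hj
    rw [Function.update_self, linMonomial]
    congr 1
    ext x
    refine Fin.cases ?_ (fun x => ?_) x
    · rw [homExponent_zero, sum_pair_apply]
      simp [hij]
    · rw [homExponent_succ]
      simp [Finsupp.single_apply, hij]
  · rw [Function.update_of_ne hj]
    by_cases hi : s = i
    · subst hi
      rw [Function.update_self, linMonomial]
      congr 1
      ext x
      refine Fin.cases ?_ (fun x => ?_) x
      · rw [homExponent_zero, sum_pair_apply]
        simp [hij.symm]
      · rw [homExponent_succ]
        simp [Finsupp.single_apply, hij.symm]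
    · rw [Function.update_of_ne hi, homExponent_of_forall_eq_zero, x0Pow_eq_scaledMonomial]
      intro x
      rw [Finsupp.add_apply, Finsupp.single_eq_of_ne (sigma_mk_ne hi _ _),
        Finsupp.single_eq_of_ne (sigma_mk_ne hj _ _), add_zero]

theorem tensorG_eq {i j : Fin r} (hij : i ≠ j) (g : Matrix (Fin (n i)) (Fin (n j)) ℝ) :
    tensorG n d i j g =
      ∑ k, ∑ l, g k l • affineMonomial n d (pairExponent ⟨i, k⟩ ⟨j, l⟩) := by
  simp only [tensorG, simpleTensor_update_update hij]

/-- Expand linearly in slot i. The squares are the case l = k of the pair exponent, so the two sums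
of `quadPoly` merge into one over k ≤ l. -/
theorem tensorW_eq (i : Fin r) (f : Matrix (Fin (n i)) (Fin (n i)) ℝ) :
    tensorW n d i f =
      ∑ k, ∑ l ∈ Finset.Ici k, f k l • affineMonomial n d (pairExponent ⟨i, k⟩ ⟨i, l⟩) := by
  let Λ : HomPoly (n i) (d i) →ₗ[ℝ] PSTensor n d :=
    (PiTensorProduct.tprod ℝ).toLinearMap (fun j => x0Pow (n j) (d j)) i
  have hΛ : ∀ f, simpleTensor (Function.update (fun j => x0Pow (n j) (d j)) i f) = Λ f :=
    fun _ => rfl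
  have h2 : ∀ k : Fin (n i), Finsupp.single 0 (d i - 2) + Finsupp.single k.succ 2 =
      Finsupp.single 0 (d i - 2) + Finsupp.single k.succ 1 + Finsupp.single k.succ 1 := fun k => by
    rw [add_assoc, ← Finsupp.single_add]
  rw [tensorW, hΛ, quadPoly, map_add, map_sum, map_sum, ← Finset.sum_add_distrib]
  refine Finset.sum_congr rfl fun k _ => ?_
  rw [map_sum, ← Finset.Ioi_insert, Finset.sum_insert (by simp), add_comm, h2]
  simp only [map_smul]
  simp only [← hΛ, simpleTensor_update_quad]

/-! ### The components of the normal space -/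

theorem sum_affineExponent_of_eq {α : ∀ i, MultiIndex (n i) (d i)} {i : Fin r} {c : ℕ}
    (h : (α i).1 0 + c = d i) : ∑ k, affineExponent α ⟨i, k⟩ = c := by
  have := zero_add_sum_affineExponent α i
  lia

theorem exists_eq_pairExponent {m : (Σ i, Fin (n i)) →₀ ℕ} (h : ∑ i, ∑ k, m ⟨i, k⟩ = 2) :
    ∃ p q, m = pairExponent p q := by
  rw [← Fintype.sum_sigma (f := fun p => m p), ← Finsupp.degree_eq_sum] at h
  obtain ⟨p, m', rfl, h'⟩ := exists_eq_single_add h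
  obtain ⟨q, m'', rfl, h''⟩ := exists_eq_single_add h'
  exact ⟨p, q, by rw [(Finsupp.degree_eq_zero_iff _).1 h'', add_zero]⟩

theorem affineMonomial_pair_mem_spaceWi (i : Fin r) (k l : Fin (n i)) :
    affineMonomial n d (pairExponent ⟨i, k⟩ ⟨i, l⟩) ∈ spaceWi n d i := by
  by_cases hi : 2 ≤ d i
  · have ha := (isAdmissible_pair_of_eq k l).2 hi
    refine Submodule.subset_span ⟨basisIndex _ ha, ?_, fun j hj => ?_, rfl⟩
    · rw [basisIndex, homExponent_zero, sum_pair_apply]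
      simpa using Nat.sub_add_cancel hi
    · rw [basisIndex, homExponent_zero, sum_pair_apply]
      simp [hj.symm]
  · rw [affineMonomial_eq_zero (mt (isAdmissible_pair_of_eq k l).1 hi)]
    exact zero_mem _

/-- The condition on x_0-exponents says that the affine exponent has total degree two, all in block
i. Hence each generator is a pair monomial of that block. -/
theorem spaceWi_le {i : Fin r} {S : Submodule ℝ (PSTensor n d)}
    (h : ∀ k l, affineMonomial n d (pairExponent ⟨i, k⟩ ⟨i, l⟩) ∈ S) : spaceWi n d i ≤ S := by
  refine Submodule.span_le.2 ?_
  rintro _ ⟨α, hα, hα', rfl⟩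
  have hi := sum_affineExponent_of_eq hα
  have hne : ∀ j, j ≠ i → ∑ k, affineExponent α ⟨j, k⟩ = 0 := fun j hj =>
    sum_affineExponent_of_eq (by rw [add_zero, hα' j hj])
  obtain ⟨⟨a, k⟩, ⟨b, l⟩, hpq⟩ := exists_eq_pairExponent (m := affineExponent α)
    (by rw [Finset.sum_eq_single i (fun j _ hj => hne j hj) (by simp), hi])
  have ha : a = i := by
    by_contra h
    have := hne a h
    rw [hpq, sum_pair_apply] at this
    simp at this
  have hb : b = i := by
    by_contra h
    have := hne b h
    rw [hpq, sum_pair_apply] at this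
    simp at this
  subst ha
  subst hb
  rw [← tensorBasis_apply, ← affineMonomial_affineExponent, hpq]
  exact h k l

theorem affineMonomial_pair_mem_spaceGij (hd : ∀ i, 1 ≤ d i) {i j : Fin r} (hij : i ≠ j)
    (k : Fin (n i)) (l : Fin (n j)) :
    affineMonomial n d (pairExponent ⟨i, k⟩ ⟨j, l⟩) ∈ spaceGij n d i j := by
  have ha : IsAdmissible d (pairExponent ⟨i, k⟩ ⟨j, l⟩) := isAdmissible_pair_of_ne hd hij
  refine Submodule.subset_span ⟨basisIndex _ ha, ?_, ?_, fun s hsi hsj => ?_, rfl⟩ <;>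
    rw [basisIndex, homExponent_zero, sum_pair_apply]
  · simpa [hij.symm] using Nat.sub_add_cancel (hd i)
  · simpa [hij] using Nat.sub_add_cancel (hd j)
  · simp [hsi.symm, hsj.symm]

theorem spaceGij_le {i j : Fin r} (hij : i ≠ j) {S : Submodule ℝ (PSTensor n d)}
    (h : ∀ k l, affineMonomial n d (pairExponent ⟨i, k⟩ ⟨j, l⟩) ∈ S) :
    spaceGij n d i j ≤ S := by
  refine Submodule.span_le.2 ?_
  rintro _ ⟨α, hαi, hαj, hα', rfl⟩
  have hi := sum_affineExponent_of_eq hαi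
  have hj := sum_affineExponent_of_eq hαj
  have hne : ∀ s, s ≠ i → s ≠ j → ∑ k, affineExponent α ⟨s, k⟩ = 0 := fun s hsi hsj =>
    sum_affineExponent_of_eq (by rw [add_zero, hα' s hsi hsj])
  obtain ⟨⟨a, k⟩, ⟨b, l⟩, hpq⟩ := exists_eq_pairExponent (m := affineExponent α)
    (by rw [Finset.sum_eq_add i j hij (fun s _ hs => hne s hs.1 hs.2) (by simp) (by simp), hi, hj])
  -- The two variables of a pair exponent come unordered.
  have key : a = i ∧ b = j ∨ a = j ∧ b = i := by
    rw [hpq, sum_pair_apply] at hi hj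
    split_ifs at hi hj <;> simp_all
  rw [← tensorBasis_apply, ← affineMonomial_affineExponent, hpq]
  rcases key with ⟨rfl, rfl⟩ | ⟨rfl, rfl⟩
  · exact h k l
  · rw [pairExponent, add_comm]
    exact h l k

theorem inner_eq_zero_of_mem_spaceWi {i : Fin r} {m : (Σ i, Fin (n i)) →₀ ℕ}
    (hm : ∀ k l, m ≠ pairExponent ⟨i, k⟩ ⟨i, l⟩) {F : PSTensor n d} (hF : F ∈ spaceWi n d i) :
    ⟪affineMonomial n d m, F⟫_ℝ = 0 :=
  Submodule.mem_orthogonal_singleton_iff_inner_right.1 (spaceWi_le (fun k l =>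
    Submodule.mem_orthogonal_singleton_iff_inner_right.2 (inner_affineMonomial_of_ne (hm k l))) hF)

theorem inner_eq_zero_of_mem_spaceGij {i j : Fin r} (hij : i ≠ j) {m : (Σ i, Fin (n i)) →₀ ℕ}
    (hm : ∀ k l, m ≠ pairExponent ⟨i, k⟩ ⟨j, l⟩) {F : PSTensor n d} (hF : F ∈ spaceGij n d i j) :
    ⟪affineMonomial n d m, F⟫_ℝ = 0 :=
  Submodule.mem_orthogonal_singleton_iff_inner_right.1 (spaceGij_le hij (fun k l =>
    Submodule.mem_orthogonal_singleton_iff_inner_right.2 (inner_affineMonomial_of_ne (hm k l))) hF)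

theorem pairExponent_ne {p q p' q' : Σ i, Fin (n i)}
    (h : ¬(p.1 = p'.1 ∧ q.1 = q'.1 ∨ p.1 = q'.1 ∧ q.1 = p'.1)) :
    pairExponent p q ≠ pairExponent p' q' := by
  rw [Ne, single_add_single_eq_iff]
  rintro (⟨rfl, rfl⟩ | ⟨rfl, rfl⟩) <;> simp at h

theorem spaceWi_isOrtho {i j : Fin r} (hij : i ≠ j) : spaceWi n d i ⟂ spaceWi n d j := by
  rw [Submodule.isOrtho_iff_le]
  refine spaceWi_le fun k l => (Submodule.mem_orthogonal' _ _).2 fun F hF =>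
    inner_eq_zero_of_mem_spaceWi (fun k' l' => pairExponent_ne ?_) hF
  simp [hij]

theorem spaceWi_isOrtho_spaceGij {a i j : Fin r} (hij : i ≠ j) :
    spaceWi n d a ⟂ spaceGij n d i j := by
  rw [Submodule.isOrtho_iff_le]
  refine spaceWi_le fun k l => (Submodule.mem_orthogonal' _ _).2 fun F hF =>
    inner_eq_zero_of_mem_spaceGij hij (fun k' l' => pairExponent_ne ?_) hF
  rintro (⟨h, h'⟩ | ⟨h, h'⟩)
  · exact hij (h.symm.trans h')
  · exact hij (h'.symm.trans h)

theorem spaceGij_isOrtho {i j k l : Fin r} (hij : i < j) (hkl : k < l)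
    (h : (i, j) ≠ (k, l)) : spaceGij n d i j ⟂ spaceGij n d k l := by
  rw [Submodule.isOrtho_iff_le]
  refine spaceGij_le hij.ne fun x y => (Submodule.mem_orthogonal' _ _).2 fun F hF =>
    inner_eq_zero_of_mem_spaceGij hkl.ne (fun k' l' => pairExponent_ne ?_) hF
  rintro (⟨h1, h2⟩ | ⟨h1, h2⟩)
  · exact h (Prod.ext h1 h2)
  · simp only at h1 h2
    subst h1 h2
    exact lt_asymm hij hkl

theorem tensorW_mem_spaceWi (i : Fin r) (f : Matrix (Fin (n i)) (Fin (n i)) ℝ) :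
    tensorW n d i f ∈ spaceWi n d i := by
  rw [tensorW_eq]
  exact Submodule.sum_mem _ fun k _ => Submodule.sum_mem _ fun l _ =>
    Submodule.smul_mem _ _ (affineMonomial_pair_mem_spaceWi i k l)

theorem tensorG_mem_spaceGij (hd : ∀ i, 1 ≤ d i) {i j : Fin r} (hij : i ≠ j)
    (g : Matrix (Fin (n i)) (Fin (n j)) ℝ) : tensorG n d i j g ∈ spaceGij n d i j := by
  rw [tensorG_eq hij]
  exact Submodule.sum_mem _ fun k _ => Submodule.sum_mem _ fun l _ =>
    Submodule.smul_mem _ _ (affineMonomial_pair_mem_spaceGij hd hij k l)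

theorem inner_pair_tensorW {i : Fin r} (hi : 2 ≤ d i) {f : Matrix (Fin (n i)) (Fin (n i)) ℝ}
    (hf : f.IsSymm) (k l : Fin (n i)) :
    ⟪affineMonomial n d (pairExponent ⟨i, k⟩ ⟨i, l⟩), tensorW n d i f⟫_ℝ = f k l := by
  -- `tensorW` only reads the entries with k ≤ l; symmetry of f supplies the rest.
  wlog hkl : k ≤ l generalizing k l
  · rw [pairExponent, add_comm, this l k (le_of_not_ge hkl), hf.apply]
  have hne : ∀ k' l', k' ≤ l' → ¬(k' = k ∧ l' = l) →
      pairExponent (⟨i, k⟩ : Σ i, Fin (n i)) ⟨i, l⟩ ≠ pairExponent ⟨i, k'⟩ ⟨i, l'⟩ := by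
    intro k' l' hkl' h
    rw [Ne, single_add_single_eq_iff]
    simp only [sigma_mk_eq_iff]
    rintro (⟨rfl, rfl⟩ | ⟨rfl, rfl⟩)
    · exact h ⟨rfl, rfl⟩
    · obtain rfl := le_antisymm hkl hkl'
      exact h ⟨rfl, rfl⟩
  simp only [tensorW_eq, inner_sum, inner_smul_right]
  rw [Finset.sum_eq_single k, Finset.sum_eq_single l]
  · rw [inner_affineMonomial_self ((isAdmissible_pair_of_eq k l).2 hi), mul_one]
  · intro l' hl' h
    rw [inner_affineMonomial_of_ne (hne _ _ (Finset.mem_Ici.1 hl') fun h' => h h'.2), mul_zero]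
  · intro h
    exact absurd (Finset.mem_Ici.2 hkl) h
  · intro k' _ h
    refine Finset.sum_eq_zero fun l' hl' => ?_
    rw [inner_affineMonomial_of_ne (hne _ _ (Finset.mem_Ici.1 hl') fun h' => h h'.1), mul_zero]
  · simp

theorem inner_pair_tensorG (hd : ∀ i, 1 ≤ d i) {i j : Fin r} (hij : i ≠ j)
    (g : Matrix (Fin (n i)) (Fin (n j)) ℝ) (k : Fin (n i)) (l : Fin (n j)) :
    ⟪affineMonomial n d (pairExponent ⟨i, k⟩ ⟨j, l⟩), tensorG n d i j g⟫_ℝ = g k l := by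
  have hne : ∀ k' l', ¬(k' = k ∧ l' = l) →
      pairExponent (⟨i, k⟩ : Σ i, Fin (n i)) ⟨j, l⟩ ≠ pairExponent ⟨i, k'⟩ ⟨j, l'⟩ := by
    intro k' l' h
    rw [Ne, single_add_single_eq_iff]
    simp only [sigma_mk_eq_iff]
    rintro (⟨rfl, rfl⟩ | ⟨h', -⟩)
    · exact h ⟨rfl, rfl⟩
    · exact sigma_mk_ne hij _ _ h'
  simp only [tensorG_eq hij, inner_sum, inner_smul_right]
  rw [Finset.sum_eq_single k, Finset.sum_eq_single l]
  · rw [inner_affineMonomial_self, mul_one]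
    exact isAdmissible_pair_of_ne hd hij
  · intro l' _ h
    rw [inner_affineMonomial_of_ne (hne _ _ fun h' => h h'.2), mul_zero]
  · simp
  · intro k' _ h
    refine Finset.sum_eq_zero fun l' _ => ?_
    rw [inner_affineMonomial_of_ne (hne _ _ fun h' => h h'.1), mul_zero]
  · simp

/-- The matrix consists of the inner products with pair monomials. Testing is needed only on
admissible monomials, and admissibility of a pair in block i yields the bound d_i ≥ 2 needed to read
off an entry. -/
theorem mem_spaceWi_iff (i : Fin r) (F : PSTensor n d) :
    F ∈ spaceWi n d i ↔
      ∃ f : Matrix (Fin (n i)) (Fin (n i)) ℝ, f.IsSymm ∧ F = tensorW n d i f := by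
  constructor
  · intro hF
    have hf : (Matrix.of fun k l =>
        ⟪affineMonomial n d (pairExponent ⟨i, k⟩ ⟨i, l⟩), F⟫_ℝ).IsSymm :=
      Matrix.IsSymm.ext fun k l => by rw [Matrix.of_apply, Matrix.of_apply, pairExponent, add_comm]
    refine ⟨_, hf, ext_inner_affineMonomial fun m hm => ?_⟩
    by_cases h : ∃ k l, m = pairExponent ⟨i, k⟩ ⟨i, l⟩
    · obtain ⟨k, l, rfl⟩ := h
      rw [inner_pair_tensorW ((isAdmissible_pair_of_eq k l).1 hm) hf, Matrix.of_apply]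
    · push Not at h
      rw [inner_eq_zero_of_mem_spaceWi h hF,
        inner_eq_zero_of_mem_spaceWi h (tensorW_mem_spaceWi i _)]
  · rintro ⟨f, -, rfl⟩
    exact tensorW_mem_spaceWi i f

theorem mem_spaceGij_iff (hd : ∀ i, 1 ≤ d i) {i j : Fin r} (hij : i ≠ j) (F : PSTensor n d) :
    F ∈ spaceGij n d i j ↔
      ∃ g : Matrix (Fin (n i)) (Fin (n j)) ℝ, F = tensorG n d i j g := by
  constructor
  · intro hF
    refine ⟨Matrix.of fun k l => ⟪affineMonomial n d (pairExponent ⟨i, k⟩ ⟨j, l⟩), F⟫_ℝ,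
      ext_inner_affineMonomial fun m hm => ?_⟩
    by_cases h : ∃ k l, m = pairExponent ⟨i, k⟩ ⟨j, l⟩
    · obtain ⟨k, l, rfl⟩ := h
      rw [inner_pair_tensorG hd hij, Matrix.of_apply]
    · push Not at h
      rw [inner_eq_zero_of_mem_spaceGij hij h hF,
        inner_eq_zero_of_mem_spaceGij hij h (tensorG_mem_spaceGij hd hij _)]
  · rintro ⟨g, rfl⟩
    exact tensorG_mem_spaceGij hd hij g

theorem spaceWi_le_spaceW (i : Fin r) : spaceWi n d i ≤ spaceW n d := le_iSup (spaceWi n d) i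

theorem spaceGij_le_spaceG {i j : Fin r} (hij : i < j) : spaceGij n d i j ≤ spaceG n d :=
  le_iSup₂_of_le i j (le_iSup (fun _ : i < j => spaceGij n d i j) hij)

theorem spaceW_isOrtho_spaceG : spaceW n d ⟂ spaceG n d := by
  simp only [spaceW, spaceG, Submodule.isOrtho_iSup_left, Submodule.isOrtho_iSup_right]
  exact fun i j h a => spaceWi_isOrtho_spaceGij h.ne

theorem inner_pair_sum_of_eq {i : Fin r} (hi : 2 ≤ d i) (hd : ∀ i, 1 ≤ d i)
    {f : ∀ i, Matrix (Fin (n i)) (Fin (n i)) ℝ} (hf : ∀ i, (f i).IsSymm)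
    (g : ∀ i j, Matrix (Fin (n i)) (Fin (n j)) ℝ) (k l : Fin (n i)) :
    ⟪affineMonomial n d (pairExponent ⟨i, k⟩ ⟨i, l⟩), ∑ i, tensorW n d i (f i) +
      ∑ i, ∑ j ∈ Finset.Ioi i, tensorG n d i j (g i j)⟫_ℝ = f i k l := by
  have hmem := affineMonomial_pair_mem_spaceWi (d := d) i k l
  rw [inner_add_right, inner_sum, inner_sum, Finset.sum_eq_single i, inner_pair_tensorW hi (hf i),
    Finset.sum_eq_zero, add_zero]
  · intro a _
    rw [inner_sum]
    exact Finset.sum_eq_zero fun b hb => (spaceWi_isOrtho_spaceGij (Finset.mem_Ioi.1 hb).ne).inner_eq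
      hmem (tensorG_mem_spaceGij hd (Finset.mem_Ioi.1 hb).ne _)
  · exact fun j _ hj => (spaceWi_isOrtho hj.symm).inner_eq hmem (tensorW_mem_spaceWi j _)
  · simp

theorem inner_pair_sum_of_lt (hd : ∀ i, 1 ≤ d i) {i j : Fin r} (hij : i < j)
    (f : ∀ i, Matrix (Fin (n i)) (Fin (n i)) ℝ)
    (g : ∀ i j, Matrix (Fin (n i)) (Fin (n j)) ℝ) (k : Fin (n i)) (l : Fin (n j)) :
    ⟪affineMonomial n d (pairExponent ⟨i, k⟩ ⟨j, l⟩), ∑ i, tensorW n d i (f i) +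
      ∑ i, ∑ j ∈ Finset.Ioi i, tensorG n d i j (g i j)⟫_ℝ = g i j k l := by
  have hmem := affineMonomial_pair_mem_spaceGij hd hij.ne k l
  have hz : ∀ a b, a < b → (i, j) ≠ (a, b) →
      ⟪affineMonomial n d (pairExponent ⟨i, k⟩ ⟨j, l⟩), tensorG n d a b (g a b)⟫_ℝ = 0 :=
    fun a b hab h => (spaceGij_isOrtho hij hab h).inner_eq hmem (tensorG_mem_spaceGij hd hab.ne _)
  rw [inner_add_right, inner_sum, inner_sum, Finset.sum_eq_zero, zero_add,
    Finset.sum_eq_single i, inner_sum, Finset.sum_eq_single j, inner_pair_tensorG hd hij.ne]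
  · exact fun b hb h => hz i b (Finset.mem_Ioi.1 hb) fun h' => h (Prod.mk.inj h').2.symm
  · exact fun h => absurd (Finset.mem_Ioi.2 hij) h
  · intro a _ h
    rw [inner_sum]
    exact Finset.sum_eq_zero fun b hb => hz a b (Finset.mem_Ioi.1 hb) fun h' =>
      h (Prod.mk.inj h').1.symm
  · simp
  · exact fun a _ => (spaceWi_isOrtho_spaceGij hij.ne).symm.inner_eq hmem (tensorW_mem_spaceWi a _)

/-! ### The tangent and normal spaces -/

/-- The tangent space is the range of DΦ(0), hence spanned by the images of the coordinate vectors.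
-/
theorem tangentSpace_segreVeronese (hd : ∀ i, 1 ≤ d i) :
    tangentSpace (segreVeronese n d) (basePoint n d) =
      Submodule.span ℝ (Set.range fun p => affineMonomial n d (Finsupp.single p 1)) := by
  classical
  rw [(isRadialGraph_segreVeronese hd).tangentSpace_eq, LinearMap.range_eq_map,
    ← (Pi.basisFun ℝ _).span_eq, Submodule.map_span, ← Set.range_comp]
  congr 2
  funext p
  simp [fderiv_affineParam hd]

theorem affineMonomial_mem_normalSpace (hd : ∀ i, 1 ≤ d i) {m : (Σ i, Fin (n i)) →₀ ℕ}
    (h0 : m ≠ 0) (h1 : ∀ p, m ≠ Finsupp.single p 1) :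
    affineMonomial n d m ∈ normalSpace (segreVeronese n d) (basePoint n d) := by
  rw [normalSpace, ← Submodule.span_singleton_le_iff_mem, Submodule.le_orthogonal_iff_le_orthogonal,
    tangentSpace_segreVeronese hd, basePoint_eq]
  refine sup_le (Submodule.span_le.2 ?_) (Submodule.span_le.2 ?_)
  · rintro _ ⟨p, rfl⟩
    exact Submodule.mem_orthogonal_singleton_iff_inner_right.2 (inner_affineMonomial_of_ne (h1 p))
  · rintro _ rfl
    exact Submodule.mem_orthogonal_singleton_iff_inner_right.2 (inner_affineMonomial_of_ne h0)

theorem affineMonomial_pair_mem_normalSpace (hd : ∀ i, 1 ≤ d i) (p q : Σ i, Fin (n i)) :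
    affineMonomial n d (pairExponent p q) ∈
      normalSpace (segreVeronese n d) (basePoint n d) := by
  refine affineMonomial_mem_normalSpace hd (fun h => ?_) fun x h => ?_ <;>
  · have := congrArg Finsupp.degree h
    simp at this

theorem spaceW_le_normalSpace (hd : ∀ i, 1 ≤ d i) :
    spaceW n d ≤ normalSpace (segreVeronese n d) (basePoint n d) :=
  iSup_le fun _ => spaceWi_le fun _ _ => affineMonomial_pair_mem_normalSpace hd _ _

theorem spaceG_le_normalSpace (hd : ∀ i, 1 ≤ d i) :
    spaceG n d ≤ normalSpace (segreVeronese n d) (basePoint n d) :=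
  iSup_le fun _ => iSup_le fun _ => iSup_le fun h => spaceGij_le h.ne fun _ _ =>
    affineMonomial_pair_mem_normalSpace hd _ _

/-- W + G lies in the normal space, and P is by definition its orthogonal complement there. -/
theorem normalSpace_eq (hd : ∀ i, 1 ≤ d i) :
    normalSpace (segreVeronese n d) (basePoint n d) = spaceP n d ⊔ spaceW n d ⊔ spaceG n d := by
  rw [sup_assoc, sup_comm, spaceP, Submodule.sup_orthogonal_inf_of_hasOrthogonalProjection
    (sup_le (spaceW_le_normalSpace hd) (spaceG_le_normalSpace hd))]

theorem spaceP_isOrtho : spaceP n d ⟂ spaceW n d ⊔ spaceG n d :=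
  (Submodule.isOrtho_iff_le).2 inf_le_left

/-- The coefficients are read off from F by inner products with pair monomials. The remainder is
then orthogonal to all pair monomials, which span W + G, and so lies in P. -/
theorem exists_decomposition (hd : ∀ i, 1 ≤ d i) {F : PSTensor n d}
    (hF : F ∈ normalSpace (segreVeronese n d) (basePoint n d)) :
    ∃ P ∈ spaceP n d, ∃ f : ∀ i, Matrix (Fin (n i)) (Fin (n i)) ℝ,
      ∃ g : ∀ i j, Matrix (Fin (n i)) (Fin (n j)) ℝ, (∀ i, (f i).IsSymm) ∧
        F = P + ∑ i, tensorW n d i (f i) +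
          ∑ i, ∑ j ∈ Finset.Ioi i, tensorG n d i j (g i j) := by
  set f : ∀ i, Matrix (Fin (n i)) (Fin (n i)) ℝ := fun i => Matrix.of fun k l =>
    ⟪affineMonomial n d (pairExponent ⟨i, k⟩ ⟨i, l⟩), F⟫_ℝ with hf
  set g : ∀ i j, Matrix (Fin (n i)) (Fin (n j)) ℝ := fun i j => Matrix.of fun k l =>
    ⟪affineMonomial n d (pairExponent ⟨i, k⟩ ⟨j, l⟩), F⟫_ℝ
  have hsymm : ∀ i, (f i).IsSymm := fun i => Matrix.IsSymm.ext fun k l => by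
    simp only [hf, Matrix.of_apply, pairExponent, add_comm]
  set S := ∑ i, tensorW n d i (f i) + ∑ i, ∑ j ∈ Finset.Ioi i, tensorG n d i j (g i j)
  have hSN : S ∈ normalSpace (segreVeronese n d) (basePoint n d) := by
    refine add_mem (sum_mem fun i _ => spaceW_le_normalSpace hd
      (spaceWi_le_spaceW i (tensorW_mem_spaceWi i _))) (sum_mem fun i _ => sum_mem fun j hj =>
      spaceG_le_normalSpace hd (spaceGij_le_spaceG (Finset.mem_Ioi.1 hj)
      (tensorG_mem_spaceGij hd (Finset.mem_Ioi.1 hj).ne _)))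
  refine ⟨F - S, ⟨?_, sub_mem hF hSN⟩, f, g, hsymm, by rw [add_assoc, sub_add_cancel]⟩
  change F - S ∈ (spaceW n d ⊔ spaceG n d)ᗮ
  rw [← Submodule.span_singleton_le_iff_mem, Submodule.le_orthogonal_iff_le_orthogonal]
  refine sup_le (iSup_le fun i => spaceWi_le fun k l => ?_) (iSup_le fun i => iSup_le fun j =>
    iSup_le fun hij => spaceGij_le hij.ne fun k l => ?_) <;>
  rw [Submodule.mem_orthogonal_singleton_iff_inner_left, inner_sub_right, sub_eq_zero]
  · by_cases hi : 2 ≤ d i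
    · rw [inner_pair_sum_of_eq hi hd hsymm]
      rfl
    · rw [affineMonomial_eq_zero (mt (isAdmissible_pair_of_eq k l).1 hi), inner_zero_left,
        inner_zero_left]
  · rw [inner_pair_sum_of_lt hd hij]
    rfl

/-! ### The Weingarten map -/

theorem exists_orthonormalBasis_tangentSpace (hd : ∀ i, 1 ≤ d i) :
    ∃ b : OrthonormalBasis (Σ i, Fin (n i)) ℝ
        (tangentSpace (segreVeronese n d) (basePoint n d)),
      ∀ i k, (b ⟨i, k⟩ : PSTensor n d) = tangentVec n d i k := by
  classical
  have hT := tangentSpace_segreVeronese hd (n := n)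
  let v : (Σ i, Fin (n i)) → tangentSpace (segreVeronese n d) (basePoint n d) := fun p =>
    ⟨affineMonomial n d (Finsupp.single p 1), hT ▸ Submodule.subset_span ⟨p, rfl⟩⟩
  have hv : Orthonormal ℝ v := by
    rw [orthonormal_iff_ite]
    intro p q
    change ⟪affineMonomial n d _, affineMonomial n d _⟫_ℝ = _
    split_ifs with h
    · rw [h, inner_affineMonomial_self (isAdmissible_single hd q)]
    · exact inner_affineMonomial_of_ne fun h' => h (Finsupp.single_left_injective one_ne_zero h')
  have hspan : ⊤ ≤ Submodule.span ℝ (Set.range v) := by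
    rw [← Submodule.map_le_map_iff_of_injective (Submodule.subtype_injective _), Submodule.map_span,
      ← Set.range_comp, Submodule.map_subtype_top]
    exact hT.le
  refine ⟨OrthonormalBasis.mk hv hspan, fun i k => ?_⟩
  rw [OrthonormalBasis.coe_mk, tangentVec_eq]

theorem tangentCoord_affineMonomial_single (hd : ∀ i, 1 ≤ d i) (p : Σ i, Fin (n i)) :
    tangentCoord n d (affineMonomial n d (Finsupp.single p 1)) = Pi.single p 1 := by
  classical
  funext q
  rw [tangentCoord_apply, Pi.single_apply]
  split_ifs with h
  · rw [h, inner_affineMonomial_self (isAdmissible_single hd p)]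
  · exact inner_affineMonomial_of_ne fun h' => h (Finsupp.single_left_injective one_ne_zero h')

theorem secondForm_basis (hd : ∀ i, 1 ≤ d i)
    {b : OrthonormalBasis (Σ i, Fin (n i)) ℝ
      (tangentSpace (segreVeronese n d) (basePoint n d))}
    (hb : ∀ i k, (b ⟨i, k⟩ : PSTensor n d) = tangentVec n d i k) (p q : Σ i, Fin (n i))
    (F : normalSpace (segreVeronese n d) (basePoint n d)) :
    IsRadialGraph.secondForm _ _ (tangentCoord n d) (affineParam n d) (b p) (b q) F =
      paramCoeff d (pairExponent p q) * (if p = q then 2 else 1) *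
        ⟪affineMonomial n d (pairExponent p q), (F : PSTensor n d)⟫_ℝ := by
  rw [IsRadialGraph.secondForm_apply, hb, hb, tangentVec_eq, tangentVec_eq,
    tangentCoord_affineMonomial_single hd, tangentCoord_affineMonomial_single hd]
  -- The direction of differentiation comes first in the Hessian, so p and q appear swapped; the
  -- formula is symmetric in them.
  refine (congrArg (fun x => ⟪x, (F : PSTensor n d)⟫_ℝ) (fderiv_fderiv_affineParam q p)).trans ?_
  rw [real_inner_smul_left, pairExponent, add_comm]
  simp only [eq_comm]

theorem diagBlock_of_eq_one {n : ℕ} (f : Matrix (Fin n) (Fin n) ℝ) : diagBlock 1 f = 0 := by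
  simp [diagBlock]

theorem secondForm_matrix (hd : ∀ i, 1 ≤ d i) {F P : PSTensor n d} (hP : P ∈ spaceP n d)
    {f : ∀ i, Matrix (Fin (n i)) (Fin (n i)) ℝ} {g : ∀ i j, Matrix (Fin (n i)) (Fin (n j)) ℝ}
    (hf : ∀ i, (f i).IsSymm)
    (hF : F = P + ∑ i, tensorW n d i (f i) +
      ∑ i, ∑ j ∈ Finset.Ioi i, tensorG n d i j (g i j)) (p q : Σ i, Fin (n i)) :
    paramCoeff d (pairExponent p q) * (if p = q then 2 else 1) *
        ⟪affineMonomial n d (pairExponent p q), F⟫_ℝ =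
      blockMatrix (fun i => diagBlock (d i) (f i)) g p q := by
  have hlt : ∀ {i j : Fin r}, i < j → ∀ k l,
      ⟪affineMonomial n d (pairExponent ⟨i, k⟩ ⟨j, l⟩), F⟫_ℝ = g i j k l := fun hij k l => by
    rw [hF, add_assoc, inner_add_right, inner_pair_sum_of_lt hd hij,
      (spaceP_isOrtho.symm).inner_eq (Submodule.mem_sup_right (spaceGij_le_spaceG hij
        (affineMonomial_pair_mem_spaceGij hd hij.ne k l))) hP, zero_add]
  obtain ⟨i, k⟩ := p
  obtain ⟨j, l⟩ := q
  rw [blockMatrix, Matrix.add_apply, Matrix.of_apply]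
  rcases lt_trichotomy i j with hij | rfl | hij
  · rw [Matrix.blockDiagonal'_apply_ne _ _ _ hij.ne, if_pos hij, zero_add, hlt hij,
      paramCoeff_pair_of_ne hd hij.ne, if_neg (sigma_mk_ne hij.ne _ _), one_mul, one_mul]
  · rw [Matrix.blockDiagonal'_apply_eq, if_neg (lt_irrefl _), if_neg (lt_irrefl _), add_zero]
    by_cases hi : 2 ≤ d i
    · rw [hF, add_assoc, inner_add_right, inner_pair_sum_of_eq hi hd hf,
        (spaceP_isOrtho.symm).inner_eq (Submodule.mem_sup_left (spaceWi_le_spaceW i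
          (affineMonomial_pair_mem_spaceWi i k l))) hP, zero_add, paramCoeff_pair_of_eq hi,
        diagBlock, Matrix.smul_apply, Matrix.of_apply]
      simp only [sigma_mk_eq_iff, smul_eq_mul]
      split_ifs with h
      · subst h
        -- The factor 2 from the Hessian of a square over the √2 in the coefficient gives the √2 on
        -- the diagonal.
        have h2 : (2 : ℝ) = √2 * √2 := (Real.mul_self_sqrt zero_le_two).symm
        have h3 : √(2 : ℝ) ≠ 0 := by positivity
        rw [div_mul_eq_mul_div, div_mul_eq_mul_div, div_eq_iff h3]
        linear_combination √(((d i : ℝ) - 1) / d i) * f i k k * h2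
      · ring
    · have h1 : d i = 1 := le_antisymm (by lia) (hd i)
      rw [affineMonomial_eq_zero (mt (isAdmissible_pair_of_eq k l).1 hi), inner_zero_left,
        mul_zero, h1, diagBlock_of_eq_one, Matrix.zero_apply]
  · rw [Matrix.blockDiagonal'_apply_ne _ _ _ hij.ne', if_neg (not_lt_of_gt hij), if_pos hij,
      zero_add, paramCoeff_pair_of_ne hd hij.ne', if_neg (sigma_mk_ne hij.ne' _ _), one_mul,
      one_mul, pairExponent, add_comm]
    exact hlt hij l k

end

end SegreVeronese

open SegreVeronese in
theorem theorem3p6 {r : ℕ} (n d : Fin r → ℕ) (hn : ∀ i, 1 ≤ n i) (hd : ∀ i, 1 ≤ d i) :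
    -- the orthogonal decomposition of the normal space
    (normalSpace (segreVeronese n d) (basePoint n d) = spaceP n d ⊔ spaceW n d ⊔ spaceG n d ∧
      spaceP n d ⟂ spaceW n d ∧ spaceP n d ⟂ spaceG n d ∧ spaceW n d ⟂ spaceG n d) ∧
    -- the components of `W` and of `G`
    (∀ i j, i ≠ j → spaceWi n d i ⟂ spaceWi n d j) ∧
    (∀ i j k l, i < j → k < l → (i, j) ≠ (k, l) → spaceGij n d i j ⟂ spaceGij n d k l) ∧
    (∀ i F, F ∈ spaceWi n d i ↔
      ∃ f : Matrix (Fin (n i)) (Fin (n i)) ℝ, f.IsSymm ∧ F = tensorW n d i f) ∧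
    (∀ i j F, i < j → (F ∈ spaceGij n d i j ↔
      ∃ g : Matrix (Fin (n i)) (Fin (n j)) ℝ, F = tensorG n d i j g)) ∧
    -- the Weingarten map in orthonormal coordinates
    ∃ b : OrthonormalBasis (Σ i, Fin (n i)) ℝ
        (tangentSpace (segreVeronese n d) (basePoint n d)),
      (∀ i k, (b ⟨i, k⟩ : PSTensor n d) = tangentVec n d i k) ∧
      ∀ F : normalSpace (segreVeronese n d) (basePoint n d),
        (∃ P ∈ spaceP n d, ∃ f : ∀ i, Matrix (Fin (n i)) (Fin (n i)) ℝ,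
          ∃ g : ∀ i j, Matrix (Fin (n i)) (Fin (n j)) ℝ, (∀ i, (f i).IsSymm) ∧
            (F : PSTensor n d) = P + ∑ i, tensorW n d i (f i) +
              ∑ i, ∑ j ∈ Finset.Ioi i, tensorG n d i j (g i j)) ∧
        ∃ L : tangentSpace (segreVeronese n d) (basePoint n d) →ₗ[ℝ]
            tangentSpace (segreVeronese n d) (basePoint n d),
          IsWeingartenMap (segreVeronese n d) (basePoint n d) F L ∧
          (∀ L', IsWeingartenMap (segreVeronese n d) (basePoint n d) F L' → L' = L) ∧
          (∀ P ∈ spaceP n d, ∀ f : ∀ i, Matrix (Fin (n i)) (Fin (n i)) ℝ,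
            ∀ g : ∀ i j, Matrix (Fin (n i)) (Fin (n j)) ℝ, (∀ i, (f i).IsSymm) →
            (F : PSTensor n d) = P + ∑ i, tensorW n d i (f i) +
              ∑ i, ∑ j ∈ Finset.Ioi i, tensorG n d i j (g i j) →
            LinearMap.toMatrix b.toBasis b.toBasis L =
              blockMatrix (fun i => diagBlock (d i) (f i)) g) ∧
          ((F : PSTensor n d) ∈ spaceP n d → L = 0) := by
  classical
  obtain ⟨b, hb⟩ := exists_orthonormalBasis_tangentSpace (n := n) hd
  refine ⟨⟨normalSpace_eq hd, spaceP_isOrtho.mono_right le_sup_left,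
    spaceP_isOrtho.mono_right le_sup_right, spaceW_isOrtho_spaceG⟩,
    fun _ _ => spaceWi_isOrtho, fun _ _ _ _ => spaceGij_isOrtho, mem_spaceWi_iff,
    fun _ _ F hij => mem_spaceGij_iff hd hij.ne F, b, hb, fun F => ?_⟩
  have hL := (isRadialGraph_segreVeronese (n := n) hd).isSecondFundamentalForm.isWeingartenMap b F
  have hmatrix : ∀ P ∈ spaceP n d, ∀ f : ∀ i, Matrix (Fin (n i)) (Fin (n i)) ℝ,
      ∀ g : ∀ i j, Matrix (Fin (n i)) (Fin (n j)) ℝ, (∀ i, (f i).IsSymm) →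
      (F : PSTensor n d) = P + ∑ i, tensorW n d i (f i) +
        ∑ i, ∑ j ∈ Finset.Ioi i, tensorG n d i j (g i j) →
      LinearMap.toMatrix b.toBasis b.toBasis (Matrix.toLin b.toBasis b.toBasis (Matrix.of fun p q =>
        IsRadialGraph.secondForm _ _ (tangentCoord n d) (affineParam n d) (b p) (b q) F)) =
        blockMatrix (fun i => diagBlock (d i) (f i)) g := by
    intro P hP f g hf hF
    ext p q
    rw [LinearMap.toMatrix_toLin, Matrix.of_apply, secondForm_basis hd hb,
      secondForm_matrix hd hP hf hF]
  refine ⟨exists_decomposition hd F.2, _, hL, fun L' hL' => hL'.unique hL, hmatrix, fun hP => ?_⟩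
  -- The matrix formula holds for every expression of F, in particular for F itself as the component
  -- in P with f = g = 0.
  have h0 := hmatrix F hP 0 0 (fun _ => Matrix.isSymm_zero)
    (by simp [tensorW_eq, tensorG])
  rw [← LinearEquiv.map_eq_zero_iff (LinearMap.toMatrix b.toBasis b.toBasis), h0]
  ext p q
  simp [blockMatrix, diagBlock, Matrix.blockDiagonal'_apply]
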